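/- Fix a set of primitive sorts and a set of primitive constants, each with a primitive sort. Let $\Gamma=(\pi,\mathcal C,\Sigma)$ be a concrete data type: a new sort $\pi$, a non-empty set $\mathcal C$ of constructors, and a signature giving every $C\in\mathcal C$ a type $\sigma_1\cdots\sigma_n\pi$, each $\sigma_i$ being $\pi$ or a primitive sort. Terms are the sorted first-order terms built from the constructors, the primitive constants and variables, with infinitely many variables of each sort. Let $\mathcal E$ be a finite set of equations between terms of sort $\pi$, and let $=_{\mathcal E}$ be the smallest congruence on terms containing all substitution instances of $\mathcal E$. *Construction functions.* A family of construction functions is a family $(f_C)_{C\in\mathcal C}$ where, for $C:\sigma_1\cdots\sigma_n\pi$, $f_C$ maps variable-free terms of sorts $\sigma_1,\dots,\sigma_n$ to variable-free terms of sort $\pi$. Its values are the primitive constants and all terms $f_C(v_1,\dots,v_n)$ with $v_1,\dots,v_n$ values. The family is *valid* if, for all constructors $C,D$ and all values $v_i,w_j$ of the right sorts, $f_C(v_1,\dots,v_n)=_{\mathcal E}C(v_1,\dots,v_n)$, and $f_C(v_1,\dots,v_n)=f_D(w_1,\dots,w_p)$ whenever $C(v_1,\dots,v_n)=_{\mathcal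 E}D(w_1,\dots,w_p)$. A map $f$ on variable-free terms of sort $\pi$ is a *valid normalization function* if $f(t)=_{\mathcal E}t$ for all $t$, and $f(t)=f(u)$ whenever $t=_{\mathcal E}u$. *Complete presentations.* A constructor $C$ is commutative if $\mathcal E$ contains $C(x,y)=C(y,x)$, for distinct variables $x,y$. Let $\mathcal E_{AC}\subseteq\mathcal E$ consist of the commutativity equations and the associativity equations ($C(x,C(y,z))=C(C(x,y),z)$, in either direction, with distinct variables) of the commutative constructors. An AC-constructor is a commutative constructor for which $\mathcal E$ contains an associativity equation. Let $=_{AC}$ be the smallest congruence containing all substitution instances of $\mathcal E_{AC}$. For a set $\mathcal R$ of rules (ordered pairs of terms of the same sort), $t\to_{\mathcal R,AC}u$ means that $u$ is obtained from $t$ by replacing a subterm that is $=_{AC}$ to $l\theta$ by $r\theta$, for a rule $l\to r$ in $\mathcal R$ and a substitution $\theta$. A *complete presentation* of $\mathcal E$ (a successful result of AC-completion) is a finite set $\mathcal R$ of rules such that - $l\succ r$ for all $l\to r$ in $\mathcal R$, for some well-founded strict ordering $\succ$ on terms that is stable by context and substitution and AC-compatible (if $t=_{AC}t'$ and $u=_{AC}u'$,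 then $t\succ u$ iff $t'\succ u'$); - $\to_{\mathcal R,AC}$ is confluent modulo AC: if $a=_{AC}b$, $a\to^*_{\mathcal R,AC}t$ and $b\to^*_{\mathcal R,AC}t'$, then there are $c=_{AC}d$ with $t\to^*_{\mathcal R,AC}c$ and $t'\to^*_{\mathcal R,AC}d$; - $=_{\mathcal E}$ is the smallest congruence containing all substitution instances of $\mathcal R\cup\mathcal E_{AC}$. *AC-normal forms.* Let $C$ be an AC-constructor. A term $t$ not headed by $C$ is both a $C$-left-comb and a $C$-right-comb, with leaves $[t]$. If $t$ is not headed by $C$, then $C(t,u)$ is a $C$-right-comb when $u$ is one, with leaves those of $u$ preceded by $t$; and $C(u,t)$ is a $C$-left-comb when $u$ is one, with leaves those of $u$ followed by $t$. Let $\mathit{orient}$ choose left or right for each constructor, and let $\le$ be a total ordering on the terms of each sort. A term is in AC-normal form if each of its subterms headed by an AC-constructor $C$ is a $C$-comb of kind $\mathit{orient}(C)$ with leaves in increasing order, and $u\le v$ for each of its subterms $C(u,v)$ with $C$ commutative but not an AC-constructor. *Normalization.* Let $\mathit{step}$ be a function on terms of sort $\pi$ that performs an $\to_{\mathcal R,AC}$-step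 if there is one and fails otherwise, and let $\mathit{norm}$ be the partial function that iterates $\mathit{step}$ until it fails. Let $\mathit{comb}$ put every subterm headed by an AC-constructor $C$ into comb form of kind $\mathit{orient}(C)$ by re-association, and let $\mathit{sort}$ permute, from the bottom up, the leaves of combs and the arguments of commutative constructors that are not AC-constructors so as to put them in increasing order. **Theorem.** 1. If $\mathcal E$ has a complete presentation, then there exists a valid family of construction functions. 2. More precisely, let $\mathcal R$ be any complete presentation of $\mathcal E$, and let $\mathit{orient}$, $\le$ and $\mathit{step}$ be arbitrary as above. Then, for every variable-free term $t$ of sort $\pi$, $\mathit{norm}(t)$ is defined and $f(t)=\mathit{sort}(\mathit{comb}(\mathit{norm}(t)))$ is a variable-free term, which is in AC-normal form and satisfies $f(t)=_{AC}\mathit{norm}(t)$. The map $f$ is a valid normalization function, and its associated family $f_C(t_1,\dots,t_n)=f(C(t_1,\dots,t_n))$ is a valid family of construction functions. -/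

import Mathlib

universe u v w x

/-- Primitive sorts and primitive constants (such as `int`, `0`, `1`), each constant with its
sort. -/
structure PrimSig where
  Srt : Type u
  Const : Type v
  sortOf : Const → Srt

/-- A concrete data type over the primitive signature `P`.  The sorts are those of `P` together
with one new sort, the sort of the data type; they are modelled by `Option P.Srt`, the new sort
being `none`.  The signature of a constructor `C` is `dom C 0, …, dom C (n - 1), none`. -/
structure CDT (P : PrimSig.{u, v}) where
  Ctor : Type w
  ctor_nonempty : Nonempty Ctor
  arity : Ctor → ℕ
  dom : (C : Ctor) → Fin (arity C) → Option P.Srt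

namespace CDT

variable {P : PrimSig.{u, v}}

/-- Sorted first-order terms with variables of sort `s` in `X s`. -/
inductive Term (Γ : CDT.{u, v, w} P) (X : Option P.Srt → Type x) :
    Option P.Srt → Type (max u v w x)
  | var {s : Option P.Srt} (y : X s) : Term Γ X s
  | const (c : P.Const) : Term Γ X (some (P.sortOf c))
  | app (C : Γ.Ctor) (ts : (i : Fin (Γ.arity C)) → Term Γ X (Γ.dom C i)) : Term Γ X none

variable {Γ : CDT.{u, v, w} P} {X : Option P.Srt → Type x}

namespace Term

/-- Terms without variables. -/
def Ground : {s : Option P.Srt} → Γ.Term X s → Prop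
  | _, var _ => False
  | _, const _ => True
  | _, app _ ts => ∀ i, Ground (ts i)

/-- Application of a (sort-preserving) substitution. -/
def subst (θ : (s : Option P.Srt) → X s → Γ.Term X s) :
    {s : Option P.Srt} → Γ.Term X s → Γ.Term X s
  | s, var y => θ s y
  | _, const c => const c
  | _, app C ts => app C fun i => subst θ (ts i)

/-- `u.Subterm t`: `u` is a subterm of `t`. -/
inductive Subterm {s : Option P.Srt} (u : Γ.Term X s) :
    {s' : Option P.Srt} → Γ.Term X s' → Prop
  | refl : Subterm u u
  | arg (C : Γ.Ctor) (ts : (i : Fin (Γ.arity C)) → Γ.Term X (Γ.dom C i))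
      (i : Fin (Γ.arity C)) : Subterm u (ts i) → Subterm u (app C ts)

/-- The term is of the form `C(…)`. -/
def HeadedBy (C : Γ.Ctor) (t : Γ.Term X none) : Prop := ∃ ts, t = app C ts

end Term

/-- The set of variable-free terms of sort `s`. -/
def GTerm (Γ : CDT.{u, v, w} P) (X : Option P.Srt → Type x) (s : Option P.Srt) :
    Type (max u v w x) :=
  {t : Γ.Term X s // t.Ground}

/-- The variable-free term `C(v₁, …, vₙ)`. -/
def GTerm.app (C : Γ.Ctor) (vs : (i : Fin (Γ.arity C)) → Γ.GTerm X (Γ.dom C i)) :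
    Γ.GTerm X none :=
  ⟨Term.app C fun i => (vs i).1, fun i => (vs i).2⟩

/-- The primitive constants as variable-free terms. -/
def GTerm.const (c : P.Const) : Γ.GTerm X (some (P.sortOf c)) :=
  ⟨Term.const c, trivial⟩

/-! ### Binary constructors -/

/-- `C` has signature `s, s, none`. -/
structure IsBin (Γ : CDT.{u, v, w} P) (C : Γ.Ctor) (s : Option P.Srt) : Prop where
  arity_eq : Γ.arity C = 2
  dom_eq : ∀ i, Γ.dom C i = s

/-- The position of the first argument of a binary constructor. -/
def IsBin.pos₀ {C : Γ.Ctor} {s : Option P.Srt} (h : Γ.IsBin C s) : Fin (Γ.arity C) :=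
  ⟨0, by rw [h.arity_eq]; decide⟩

/-- The position of the second argument of a binary constructor. -/
def IsBin.pos₁ {C : Γ.Ctor} {s : Option P.Srt} (h : Γ.IsBin C s) : Fin (Γ.arity C) :=
  ⟨1, by rw [h.arity_eq]; decide⟩

/-- The term `C(a, b)`. -/
def bin {C : Γ.Ctor} {s : Option P.Srt} (h : Γ.IsBin C s) (a b : Γ.Term X s) :
    Γ.Term X none :=
  Term.app C fun i => (h.dom_eq i).symm ▸ (if i.val = 0 then a else b)

/-! ### Equations and the theory they generate -/

/-- A pair of terms of the same sort, used for equations and for rewrite rules. -/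
abbrev TermPair (Γ : CDT.{u, v, w} P) (X : Option P.Srt → Type x) : Type (max u v w x) :=
  Σ s : Option P.Srt, Γ.Term X s × Γ.Term X s

/-- The smallest congruence containing all the substitution instances of the pairs in `A`. -/
inductive EqTheory (A : Set (Γ.TermPair X)) :
    {s : Option P.Srt} → Γ.Term X s → Γ.Term X s → Prop
  | inst {s : Option P.Srt} (l r : Γ.Term X s) (θ : (s : Option P.Srt) → X s → Γ.Term X s) :
      (⟨s, l, r⟩ : Γ.TermPair X) ∈ A → EqTheory A (l.subst θ) (r.subst θ)
  | refl {s : Option P.Srt} (t : Γ.Term X s) : EqTheory A t t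
  | symm {s : Option P.Srt} {t t' : Γ.Term X s} : EqTheory A t t' → EqTheory A t' t
  | trans {s : Option P.Srt} {t t' t'' : Γ.Term X s} :
      EqTheory A t t' → EqTheory A t' t'' → EqTheory A t t''
  | congr (C : Γ.Ctor) (ts us : (i : Fin (Γ.arity C)) → Γ.Term X (Γ.dom C i)) :
      (∀ i, EqTheory A (ts i) (us i)) → EqTheory A (Term.app C ts) (Term.app C us)

end CDT

/-- A relational data type: a concrete data type together with a finite set of equations between
terms of the sort of the data type. -/
structure RDT {P : PrimSig.{u, v}} (Γ : CDT.{u, v, w} P) (X : Option P.Srt → Type x) where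
  eqs : Set (Γ.Term X none × Γ.Term X none)
  finite : eqs.Finite

namespace RDT

open CDT

variable {P : PrimSig.{u, v}} {Γ : CDT.{u, v, w} P} {X : Option P.Srt → Type x}

/-- The relation `=_E`. -/
def Eqv (E : RDT Γ X) {s : Option P.Srt} (t t' : Γ.Term X s) : Prop :=
  EqTheory (Sigma.mk none '' E.eqs) t t'

end RDT

namespace CDT

variable {P : PrimSig.{u, v}}

/-! ### Families of construction functions -/

/-- A family of construction functions, one for every constructor. -/
def Family (Γ : CDT.{u, v, w} P) (X : Option P.Srt → Type x) : Type (max u v w x) :=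
  (C : Γ.Ctor) → ((i : Fin (Γ.arity C)) → Γ.GTerm X (Γ.dom C i)) → Γ.GTerm X none

variable {Γ : CDT.{u, v, w} P} {X : Option P.Srt → Type x}

/-- The values of a private data type: primitive constants, and whatever can be built from values
by means of the construction functions only. -/
inductive IsVal (F : Γ.Family X) : {s : Option P.Srt} → Γ.GTerm X s → Prop
  | const (c : P.Const) : IsVal F (GTerm.const c)
  | constr (C : Γ.Ctor) (vs : (i : Fin (Γ.arity C)) → Γ.GTerm X (Γ.dom C i)) :
      (∀ i, IsVal F (vs i)) → IsVal F (F C vs)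

/-- The family of construction functions associated to a map on terms:
`f_C(t₁, …, tₙ) = f(C(t₁, …, tₙ))`. -/
def familyOf (f : Γ.GTerm X none → Γ.GTerm X none) : Γ.Family X :=
  fun C ts => f (GTerm.app C ts)

end CDT

namespace RDT

open CDT

variable {P : PrimSig.{u, v}} {Γ : CDT.{u, v, w} P} {X : Option P.Srt → Type x}

/-- Validity of a family of construction functions. -/
structure IsValidFamily (E : RDT Γ X) (F : Γ.Family X) : Prop where
  correct : ∀ C vs, (∀ i, IsVal F (vs i)) → E.Eqv (F C vs).1 (GTerm.app C vs).1
  complete : ∀ C vs D ws, (∀ i, IsVal F (vs i)) → (∀ j, IsVal F (ws j)) →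
    E.Eqv (GTerm.app C vs).1 (GTerm.app D ws).1 → F C vs = F D ws

/-- Valid normalization functions. -/
structure IsValidNormalization (E : RDT Γ X) (f : Γ.GTerm X none → Γ.GTerm X none) : Prop where
  correct : ∀ t, E.Eqv (f t).1 t.1
  complete : ∀ t u, E.Eqv t.1 u.1 → f t = f u

/-! ### Associativity and commutativity -/

/-- The equation `C(y, z) = C(z, y)`, for distinct variables. -/
def IsCommEq (C : Γ.Ctor) (e : Γ.Term X none × Γ.Term X none) : Prop :=
  ∃ (s : Option P.Srt) (h : Γ.IsBin C s) (y z : X s), y ≠ z ∧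
    e = (bin h (.var y) (.var z), bin h (.var z) (.var y))

/-- The equation `C(y, C(z, z')) = C(C(y, z), z')`, for distinct variables, written in either
direction. -/
def IsAssocEq (C : Γ.Ctor) (e : Γ.Term X none × Γ.Term X none) : Prop :=
  ∃ (h : Γ.IsBin C none) (y z z' : X none), y ≠ z ∧ y ≠ z' ∧ z ≠ z' ∧
    (e = (bin h (.var y) (bin h (.var z) (.var z')), bin h (bin h (.var y) (.var z)) (.var z')) ∨
      e = (bin h (bin h (.var y) (.var z)) (.var z'), bin h (.var y) (bin h (.var z) (.var z'))))

/-- Commutative constructors. -/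
def Com (E : RDT Γ X) (C : Γ.Ctor) : Prop := ∃ e ∈ E.eqs, IsCommEq C e

/-- Associative and commutative constructors. -/
def IsAC (E : RDT Γ X) (C : Γ.Ctor) : Prop := E.Com C ∧ ∃ e ∈ E.eqs, IsAssocEq C e

theorem Com.exists_isBin {E : RDT Γ X} {C : Γ.Ctor} (h : E.Com C) : ∃ s, Γ.IsBin C s := by
  obtain ⟨_, _, s, hs, _⟩ := h
  exact ⟨s, hs⟩

theorem IsAC.isBin {E : RDT Γ X} {C : Γ.Ctor} (h : E.IsAC C) : Γ.IsBin C none := by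
  obtain ⟨_, _, _, hs, _⟩ := h
  exact hs

/-- The commutativity and associativity equations of `E` for its commutative constructors. -/
def acEqs (E : RDT Γ X) : Set (Γ.Term X none × Γ.Term X none) :=
  {e ∈ E.eqs | ∃ C, E.Com C ∧ (IsCommEq C e ∨ IsAssocEq C e)}

/-- The relation `=_AC`. -/
def ACEqv (E : RDT Γ X) {s : Option P.Srt} (t t' : Γ.Term X s) : Prop :=
  EqTheory (Sigma.mk none '' E.acEqs) t t'

/-! ### Rewriting modulo AC and complete presentations -/

/-- Rewriting with pattern matching modulo AC: a subterm that is AC-equal to an instance of a left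
hand side is replaced by the corresponding instance of the right hand side. -/
inductive Rew (E : RDT Γ X) (R : Set (Γ.TermPair X)) :
    {s : Option P.Srt} → Γ.Term X s → Γ.Term X s → Prop
  | root {s : Option P.Srt} (l r t : Γ.Term X s)
      (θ : (s : Option P.Srt) → X s → Γ.Term X s) :
      (⟨s, l, r⟩ : Γ.TermPair X) ∈ R → E.ACEqv t (l.subst θ) → Rew E R t (r.subst θ)
  | arg (C : Γ.Ctor) (ts : (i : Fin (Γ.arity C)) → Γ.Term X (Γ.dom C i))
      (i : Fin (Γ.arity C)) (t' : Γ.Term X (Γ.dom C i)) :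
      Rew E R (ts i) t' → Rew E R (Term.app C ts) (Term.app C (Function.update ts i t'))

/-- Normal forms for rewriting modulo AC. -/
def IsNormal (E : RDT Γ X) (R : Set (Γ.TermPair X)) {s : Option P.Srt} (t : Γ.Term X s) : Prop :=
  ∀ t', ¬ E.Rew R t t'

/-- Confluence modulo AC. -/
def ConfluentModAC (E : RDT Γ X) (R : Set (Γ.TermPair X)) : Prop :=
  ∀ (s : Option P.Srt) (a b t t' : Γ.Term X s), E.ACEqv a b →
    Relation.ReflTransGen (E.Rew R) a t → Relation.ReflTransGen (E.Rew R) b t' →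
    ∃ c d, Relation.ReflTransGen (E.Rew R) t c ∧ Relation.ReflTransGen (E.Rew R) t' d ∧
      E.ACEqv c d

/-- Reduction orderings: well-founded strict orderings on terms that are stable by context and
substitution. -/
structure IsReductionOrdering (gt : {s : Option P.Srt} → Γ.Term X s → Γ.Term X s → Prop) :
    Prop where
  irrefl : ∀ (s : Option P.Srt) (t : Γ.Term X s), ¬ gt t t
  trans : ∀ (s : Option P.Srt) (t t' t'' : Γ.Term X s), gt t t' → gt t' t'' → gt t t''
  wf : ∀ s : Option P.Srt, WellFounded fun t t' : Γ.Term X s => gt t' t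
  context : ∀ (C : Γ.Ctor) (ts : (i : Fin (Γ.arity C)) → Γ.Term X (Γ.dom C i))
    (i : Fin (Γ.arity C)) (t t' : Γ.Term X (Γ.dom C i)), gt t t' →
    gt (Term.app C (Function.update ts i t)) (Term.app C (Function.update ts i t'))
  subst : ∀ (s : Option P.Srt) (t t' : Γ.Term X s)
    (θ : (s : Option P.Srt) → X s → Γ.Term X s), gt t t' → gt (t.subst θ) (t'.subst θ)

/-- AC-compatibility of an ordering. -/
def ACCompatible (E : RDT Γ X) (gt : {s : Option P.Srt} → Γ.Term X s → Γ.Term X s → Prop) :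
    Prop :=
  ∀ (s : Option P.Srt) (t t' a a' : Γ.Term X s), E.ACEqv t t' → E.ACEqv a a' →
    (gt t' a' ↔ gt t a)

/-- `R` is a successful result of completion modulo AC, for some AC-compatible reduction
ordering. -/
structure IsCompletePresentation (E : RDT Γ X) (R : Set (Γ.TermPair X)) : Prop where
  finite : R.Finite
  ordered : ∃ gt : {s : Option P.Srt} → Γ.Term X s → Γ.Term X s → Prop,
    IsReductionOrdering gt ∧ E.ACCompatible gt ∧
      ∀ (s : Option P.Srt) (l r : Γ.Term X s), (⟨s, l, r⟩ : Γ.TermPair X) ∈ R → gt l r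
  confluent : E.ConfluentModAC R
  same_theory : ∀ (s : Option P.Srt) (t t' : Γ.Term X s),
    E.Eqv t t' ↔ EqTheory (R ∪ Sigma.mk none '' E.acEqs) t t'

/-- `E` has a complete presentation. -/
def HasCompletePresentation (E : RDT Γ X) : Prop := ∃ R, E.IsCompletePresentation R

/-! ### Normalization -/

/-- `step` performs one rewrite step modulo AC if there is one, and fails on normal forms. -/
structure IsStep (E : RDT Γ X) (R : Set (Γ.TermPair X))
    (step : Γ.Term X none → Option (Γ.Term X none)) : Prop where
  rew : ∀ t t', step t = some t' → E.Rew R t t'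
  normal : ∀ t, step t = none → E.IsNormal R t

/-- Apply `step` until it fails.  This is a partial function: it is undefined where the iteration
does not stop. -/
def norm (step : Γ.Term X none → Option (Γ.Term X none)) : Γ.Term X none →. Γ.Term X none :=
  StateTransition.eval step

/-- The two kinds of combs. -/
inductive Side
  | left
  | right

/-- The leaves of a `C`-left-comb or `C`-right-comb. -/
noncomputable def leaves (o : Side) {C : Γ.Ctor} (h : Γ.IsBin C none) :
    {s : Option P.Srt} → Γ.Term X s → List (Γ.Term X s)
  | _, .var y => [.var y]
  | _, .const c => [.const c]
  | _, .app D ts =>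
    open Classical in
    if hD : D = C then
      have h' : Γ.IsBin D none := hD ▸ h
      match o with
      | .right => (h'.dom_eq h'.pos₀ ▸ ts h'.pos₀ : Γ.Term X none) ::
          (h'.dom_eq h'.pos₁ ▸ leaves o h (ts h'.pos₁) : List (Γ.Term X none))
      | .left => (h'.dom_eq h'.pos₀ ▸ leaves o h (ts h'.pos₀) : List (Γ.Term X none)) ++
          [(h'.dom_eq h'.pos₁ ▸ ts h'.pos₁ : Γ.Term X none)]
    else [.app D ts]

/-- The `C`-right-comb with leaves `a :: l`. -/
def rightComb {C : Γ.Ctor} (h : Γ.IsBin C none) : Γ.Term X none → List (Γ.Term X none) →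
    Γ.Term X none
  | a, [] => a
  | a, b :: l => bin h a (rightComb h b l)

/-- The `C`-left-comb with leaves `a :: l`. -/
def leftComb {C : Γ.Ctor} (h : Γ.IsBin C none) : Γ.Term X none → List (Γ.Term X none) →
    Γ.Term X none
  | a, [] => a
  | a, b :: l => leftComb h (bin h a b) l

/-- The `C`-comb of the given kind with the given list of leaves; `dflt` is a dummy result for the
empty list, which is never the list of leaves of a term. -/
def mkComb (o : Side) {C : Γ.Ctor} (h : Γ.IsBin C none) (dflt : Γ.Term X none) :
    List (Γ.Term X none) → Γ.Term X none
  | [] => dflt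
  | a :: l => match o with
    | .right => rightComb h a l
    | .left => leftComb h a l

/-- Put all the subterms headed by an AC-constructor in comb form: the normal form with respect to
the rules `C(y, C(z, z')) → C(C(y, z), z')` for the AC-constructors `C` oriented to the left, and
`C(C(y, z), z') → C(y, C(z, z'))` for those oriented to the right. -/
noncomputable def comb (E : RDT Γ X) (orient : Γ.Ctor → Side) :
    {s : Option P.Srt} → Γ.Term X s → Γ.Term X s
  | _, .var y => .var y
  | _, .const c => .const c
  | _, .app C ts =>
    let us := fun i => comb E orient (ts i)
    open Classical in
    if h : E.IsAC C then
      have hb := h.isBin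
      mkComb (orient C) hb (.app C us)
        ((hb.dom_eq hb.pos₀ ▸ leaves (orient C) hb (us hb.pos₀) : List (Γ.Term X none)) ++
          (hb.dom_eq hb.pos₁ ▸ leaves (orient C) hb (us hb.pos₁) : List (Γ.Term X none)))
    else .app C us

/-- Permute, from the bottom up, the leaves of combs and the arguments of commutative but
non-associative constructors, so as to put them in increasing order. -/
noncomputable def sort (E : RDT Γ X) (orient : Γ.Ctor → Side) [∀ s, LinearOrder (Γ.Term X s)] :
    {s : Option P.Srt} → Γ.Term X s → Γ.Term X s
  | _, .var y => .var y
  | _, .const c => .const c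
  | _, .app C ts =>
    let us := fun i => sort E orient (ts i)
    open Classical in
    if h : E.IsAC C then
      mkComb (orient C) h.isBin (.app C us)
        ((leaves (orient C) h.isBin (.app C us)).insertionSort (· ≤ ·))
    else if h : E.Com C then
      have hb := h.exists_isBin.choose_spec
      let a : Γ.Term X h.exists_isBin.choose := hb.dom_eq hb.pos₀ ▸ us hb.pos₀
      let b : Γ.Term X h.exists_isBin.choose := hb.dom_eq hb.pos₁ ▸ us hb.pos₁
      bin hb (min a b) (max a b)
    else .app C us

/-! ### AC-normal forms -/

/-- `IsComb o h t L`: the term `t` is a `C`-comb of kind `o` and its list of leaves is `L`. -/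
inductive IsComb {C : Γ.Ctor} (h : Γ.IsBin C none) :
    Side → Γ.Term X none → List (Γ.Term X none) → Prop
  | single (o : Side) (t : Γ.Term X none) : ¬ t.HeadedBy C → IsComb h o t [t]
  | right (t t' : Γ.Term X none) (L : List (Γ.Term X none)) : ¬ t.HeadedBy C →
      IsComb h .right t' L → IsComb h .right (bin h t t') (t :: L)
  | left (t t' : Γ.Term X none) (L : List (Γ.Term X none)) : ¬ t.HeadedBy C →
      IsComb h .left t' L → IsComb h .left (bin h t' t) (L ++ [t])

/-- AC-normal forms with respect to an orientation and a total ordering. -/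
structure IsACNormal (E : RDT Γ X) (orient : Γ.Ctor → Side) [∀ s, LinearOrder (Γ.Term X s)]
    {s : Option P.Srt} (t : Γ.Term X s) : Prop where
  comb : ∀ (C : Γ.Ctor) (h : E.IsAC C) (t' : Γ.Term X none), t'.Subterm t → t'.HeadedBy C →
    ∃ L, IsComb h.isBin (orient C) t' L ∧ L.Pairwise (· ≤ ·)
  com : ∀ (C : Γ.Ctor) (s' : Option P.Srt) (h : Γ.IsBin C s') (a b : Γ.Term X s'),
    E.Com C → ¬ E.IsAC C → (bin h a b).Subterm t → a ≤ b

end RDT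

/-! The map `sort ∘ comb ∘ norm` works because each of its two stages absorbs one half of the
theory: rewriting absorbs `R`, and the canonical form absorbs AC.

Termination holds because an AC-compatible reduction ordering decreases at every step, matching
modulo AC included (`Rew.gt`). Between normal forms, confluence modulo AC collapses to AC-equality
(`IsCompletePresentation.acEqv_of_normal`). An induction over the generated congruence then shows
that terms equal in the theory have AC-equal normal forms (`church_rosser`, `acEqv_normal_of_eqv`).
So `step` may choose its redexes freely: the normal form reached is determined up to AC.

On the AC side, a term is recovered from its list of leaves (`mkComb_leaves`), and the leaves of the
canonical form of `C(a, b)` are those of the canonical forms of `a` and `b`, merged in increasing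
order (`leaves_sort_comb_bin`). Concatenation is associative and, up to permutation, commutative, so
AC-equal terms get the same canonical form (`ACEqv.sort_comb_eq`). Conversely re-association and
permutation are AC-equalities (`acEqv_sort_comb`).

Rules may introduce variables, so groundness of normal forms needs an argument (`ground_of_normal`).
If a normal form of a ground term contained `y`, swapping `y` with a fresh `z` would give another
normal form of the same term. The two would be AC-equal and hence have the same variables, which is
absurd. -/

namespace CDT

variable {P : PrimSig.{u, v}} {Γ : CDT.{u, v, w} P} {X : Option P.Srt → Type x}

/-! ### Arguments of binary constructors -/

/-- The argument of `C(…)` at the position `i`, for a binary constructor `C`. -/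
def IsBin.arg {C : Γ.Ctor} {s : Option P.Srt} (h : Γ.IsBin C s)
    (ts : (i : Fin (Γ.arity C)) → Γ.Term X (Γ.dom C i)) (i : Fin (Γ.arity C)) : Γ.Term X s :=
  h.dom_eq i ▸ ts i

theorem IsBin.eq_pos {C : Γ.Ctor} {s : Option P.Srt} (h : Γ.IsBin C s) (i : Fin (Γ.arity C)) :
    i = h.pos₀ ∨ i = h.pos₁ := by
  have h1 := i.isLt
  have h2 := h.arity_eq
  rcases (by omega : i.val = 0 ∨ i.val = 1) with h3 | h3
  · exact Or.inl (Fin.ext h3)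
  · exact Or.inr (Fin.ext h3)

theorem IsBin.sort_unique {C : Γ.Ctor} {s s' : Option P.Srt} (h : Γ.IsBin C s)
    (h' : Γ.IsBin C s') : s = s' :=
  (h.dom_eq h.pos₀).symm.trans (h'.dom_eq _)

/-- The arguments of a binary constructor have sort `Γ.dom C i`, equal to `s` only propositionally.
This and the next two facts handle the resulting transports, after which `IsBin.arg` and `bin` hide
them. -/
theorem cast_symm_cast {F : Option P.Srt → Type*} {a b : Option P.Srt} (e : a = b) (z : F a) :
    e.symm ▸ (e ▸ z : F b) = z := by
  subst e; rfl

theorem cast_cast_symm {F : Option P.Srt → Type*} {a b : Option P.Srt} (e : a = b) (z : F b) :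
    (e ▸ (e.symm ▸ z : F a) : F b) = z := by
  subst e; rfl

theorem apply_cast {F G : Option P.Srt → Type*} (f : (s : Option P.Srt) → F s → G s)
    {a b : Option P.Srt} (e : a = b) (z : F a) : f b (e ▸ z) = e ▸ f a z := by
  subst e; rfl

theorem app_eq_bin {C : Γ.Ctor} {s : Option P.Srt} (h : Γ.IsBin C s)
    (ts : (i : Fin (Γ.arity C)) → Γ.Term X (Γ.dom C i)) :
    Term.app C ts = bin h (h.arg ts h.pos₀) (h.arg ts h.pos₁) := by
  unfold bin
  congr 1
  funext i
  rcases h.eq_pos i with rfl | rfl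
  · exact (cast_symm_cast (F := fun s => Γ.Term X s) (h.dom_eq _) _).symm
  · exact (cast_symm_cast (F := fun s => Γ.Term X s) (h.dom_eq _) _).symm

/-- The family of the two arguments of `C(a, b)`. -/
def binArgs {C : Γ.Ctor} {s : Option P.Srt} (h : Γ.IsBin C s) (a b : Γ.Term X s) :
    (i : Fin (Γ.arity C)) → Γ.Term X (Γ.dom C i) :=
  fun i => (h.dom_eq i).symm ▸ (if i.val = 0 then a else b)

theorem bin_eq_app {C : Γ.Ctor} {s : Option P.Srt} (h : Γ.IsBin C s) (a b : Γ.Term X s) :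
    bin h a b = Term.app C (binArgs h a b) := rfl

@[simp] theorem IsBin.arg_binArgs₀ {C : Γ.Ctor} {s : Option P.Srt} (h : Γ.IsBin C s)
    (a b : Γ.Term X s) : h.arg (binArgs h a b) h.pos₀ = a :=
  cast_cast_symm (F := fun s => Γ.Term X s) (h.dom_eq _) _

@[simp] theorem IsBin.arg_binArgs₁ {C : Γ.Ctor} {s : Option P.Srt} (h : Γ.IsBin C s)
    (a b : Γ.Term X s) : h.arg (binArgs h a b) h.pos₁ = b :=
  cast_cast_symm (F := fun s => Γ.Term X s) (h.dom_eq _) _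

theorem IsBin.arg_map {C : Γ.Ctor} {s : Option P.Srt} (h : Γ.IsBin C s)
    (f : {s : Option P.Srt} → Γ.Term X s → Γ.Term X s)
    (ts : (i : Fin (Γ.arity C)) → Γ.Term X (Γ.dom C i)) (i : Fin (Γ.arity C)) :
    h.arg (fun i => f (ts i)) i = f (h.arg ts i) :=
  (apply_cast (F := fun s => Γ.Term X s) (G := fun s => Γ.Term X s) (fun _ t => f t)
    (h.dom_eq i) (ts i)).symm

theorem prop_arg {C : Γ.Ctor} {s : Option P.Srt} (h : Γ.IsBin C s)
    {p : {s : Option P.Srt} → Γ.Term X s → Prop} {ts : (i : Fin (Γ.arity C)) → Γ.Term X (Γ.dom C i)}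
    (i : Fin (Γ.arity C)) : p (h.arg ts i) ↔ p (ts i) :=
  iff_of_eq (by
    have : ∀ {a b : Option P.Srt} (e : a = b) (z : Γ.Term X a), p (e ▸ z) = p z := by
      intro a b e z; subst e; rfl
    exact this _ _)

theorem rel_arg {C : Γ.Ctor} {s : Option P.Srt} (h : Γ.IsBin C s)
    {p : {s : Option P.Srt} → Γ.Term X s → Γ.Term X s → Prop}
    {ts us : (i : Fin (Γ.arity C)) → Γ.Term X (Γ.dom C i)}
    (i : Fin (Γ.arity C)) : p (h.arg ts i) (h.arg us i) ↔ p (ts i) (us i) :=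
  iff_of_eq (by
    have : ∀ {a b : Option P.Srt} (e : a = b) (y z : Γ.Term X a), p (e ▸ y) (e ▸ z) = p y z := by
      intro a b e y z; subst e; rfl
    exact this _ _ _)

theorem bin_eq_bin {C : Γ.Ctor} {s : Option P.Srt} (h h' : Γ.IsBin C s) {a b a' b' : Γ.Term X s}
    (e : bin h a b = bin h' a' b') : a = a' ∧ b = b' := by
  have e' : binArgs h a b = binArgs h a' b' := by
    simpa only [bin_eq_app, Term.app.injEq, heq_eq_eq, true_and] using e
  constructor
  · rw [← h.arg_binArgs₀ a b, e', h.arg_binArgs₀]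
  · rw [← h.arg_binArgs₁ a b, e', h.arg_binArgs₁]

theorem EqTheory.bin {A : Set (Γ.TermPair X)} {C : Γ.Ctor} {s : Option P.Srt} (h : Γ.IsBin C s)
    {a b a' b' : Γ.Term X s} (ha : EqTheory A a a') (hb : EqTheory A b b') :
    EqTheory A (CDT.bin h a b) (CDT.bin h a' b') := by
  refine EqTheory.congr C (binArgs h a b) (binArgs h a' b') fun i => ?_
  rw [← rel_arg h (p := fun t t' => EqTheory A t t')]
  rcases h.eq_pos i with rfl | rfl <;> simpa

namespace Term

theorem subst_bin {C : Γ.Ctor} {s : Option P.Srt} (h : Γ.IsBin C s)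
    (θ : (s : Option P.Srt) → X s → Γ.Term X s) (a b : Γ.Term X s) :
    (bin h a b).subst θ = bin h (a.subst θ) (b.subst θ) := by
  rw [bin_eq_app, subst, app_eq_bin h, h.arg_map (fun t => subst θ t),
    h.arg_map (fun t => subst θ t), h.arg_binArgs₀, h.arg_binArgs₁]

/-- Induction on a term seen as built with the binary constructor `C` from terms not headed
by `C`. -/
theorem binInduction {C : Γ.Ctor} (h : Γ.IsBin C none) {p : Γ.Term X none → Prop}
    (leaf : ∀ t, ¬ t.HeadedBy C → p t) (node : ∀ a b, p a → p b → p (bin h a b))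
    (t : Γ.Term X none) : p t := by
  -- Structural induction needs a variable sort index, so the sort is freed and tied back to `none`
  -- by an equation.
  have key : ∀ (s : Option P.Srt) (t : Γ.Term X s) (e : s = none), p (e ▸ t) := by
    intro s t
    induction t with
    | var y =>
      rintro rfl
      exact leaf _ (by rintro ⟨ts, hts⟩; cases hts)
    | const c => intro e; cases e
    | app D ts ih =>
      intro e
      by_cases hD : D = C
      · subst hD
        change p (Term.app D ts)
        rw [app_eq_bin h]
        exact node _ _ (ih _ _) (ih _ _)
      · exact leaf _ (by rintro ⟨us, hus⟩; cases hus; exact hD rfl)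
  exact key none t rfl

/-! ### Variables of a term -/

/-- The variables that occur in a term. -/
def vars : {s : Option P.Srt} → Γ.Term X s → Set (Σ s, X s)
  | s, var y => {⟨s, y⟩}
  | _, const _ => ∅
  | _, app _ ts => ⋃ i, vars (ts i)

theorem finite_vars {s : Option P.Srt} (t : Γ.Term X s) : t.vars.Finite := by
  induction t with
  | var y => exact Set.finite_singleton _
  | const c => exact Set.finite_empty
  | app C ts ih => exact Set.finite_iUnion ih

/-- Groundness is handled through variable sets because these are an invariant of `=_AC`. -/
theorem ground_iff_vars {s : Option P.Srt} (t : Γ.Term X s) : t.Ground ↔ t.vars = ∅ := by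
  induction t with
  | var y => simp [Ground, vars]
  | const c => simp [Ground, vars]
  | app C ts ih => simp only [Ground, vars, Set.iUnion_eq_empty, ih]

theorem vars_subst {s : Option P.Srt} (θ : (s : Option P.Srt) → X s → Γ.Term X s)
    (t : Γ.Term X s) : (t.subst θ).vars = ⋃ p ∈ t.vars, (θ p.1 p.2).vars := by
  induction t with
  | var y => simp [subst, vars]
  | const c => simp [subst, vars]
  | app C ts ih =>
    simp only [subst, vars, ih]
    ext q
    simp only [Set.mem_iUnion, exists_prop]
    exact ⟨fun ⟨i, p, hp, hq⟩ => ⟨p, ⟨i, hp⟩, hq⟩, fun ⟨p, ⟨i, hp⟩, hq⟩ => ⟨i, p, hp, hq⟩⟩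

theorem vars_bin {C : Γ.Ctor} {s : Option P.Srt} (h : Γ.IsBin C s) (a b : Γ.Term X s) :
    (bin h a b).vars = a.vars ∪ b.vars := by
  ext q
  have h' := fun i => prop_arg h (p := fun t => q ∈ t.vars) (ts := binArgs h a b) i
  have h₀ := h' h.pos₀
  have h₁ := h' h.pos₁
  rw [h.arg_binArgs₀] at h₀
  rw [h.arg_binArgs₁] at h₁
  simp only [bin_eq_app, vars, Set.mem_iUnion, Set.mem_union]
  constructor
  · rintro ⟨i, hi⟩
    rcases h.eq_pos i with rfl | rfl
    · exact Or.inl (h₀.2 hi)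
    · exact Or.inr (h₁.2 hi)
  · rintro (hq | hq)
    · exact ⟨_, h₀.1 hq⟩
    · exact ⟨_, h₁.1 hq⟩

theorem subst_subst {s : Option P.Srt} (θ η : (s : Option P.Srt) → X s → Γ.Term X s)
    (t : Γ.Term X s) : (t.subst θ).subst η = t.subst fun s y => (θ s y).subst η := by
  induction t with
  | var y => rfl
  | const c => rfl
  | app C ts ih => simp only [subst, ih]

theorem subst_var {s : Option P.Srt} (t : Γ.Term X s) : t.subst (fun _ y => .var y) = t := by
  induction t with
  | var y => rfl
  | const c => rfl
  | app C ts ih => simp only [subst, ih]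

theorem subst_eq_self_of_ground {s : Option P.Srt} (θ : (s : Option P.Srt) → X s → Γ.Term X s)
    {t : Γ.Term X s} (ht : t.Ground) : t.subst θ = t := by
  induction t with
  | var y => exact ht.elim
  | const c => rfl
  | app C ts ih =>
    simp only [subst]
    congr 1
    funext i
    exact ih i (ht i)

end Term

/-! ### Stability and monotonicity of the generated congruence. -/

theorem EqTheory.subst {A : Set (Γ.TermPair X)} {s : Option P.Srt} {t t' : Γ.Term X s}
    (h : EqTheory A t t') (η : (s : Option P.Srt) → X s → Γ.Term X s) :
    EqTheory A (t.subst η) (t'.subst η) := by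
  induction h with
  | inst l r θ hlr =>
    rw [Term.subst_subst, Term.subst_subst]
    exact .inst l r _ hlr
  | refl t => exact .refl _
  | symm _ ih => exact ih.symm
  | trans _ _ ih ih' => exact ih.trans ih'
  | congr C ts us _ ih => exact .congr C _ _ ih

theorem EqTheory.mono {A B : Set (Γ.TermPair X)} (hAB : A ⊆ B) {s : Option P.Srt}
    {t t' : Γ.Term X s} (h : EqTheory A t t') : EqTheory B t t' := by
  induction h with
  | inst l r θ hlr => exact .inst l r θ (hAB hlr)
  | refl t => exact .refl _
  | symm _ ih => exact ih.symm
  | trans _ _ ih ih' => exact ih.trans ih'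
  | congr C ts us _ ih => exact .congr C _ _ ih

end CDT

/-! ### Equality modulo AC. -/

namespace RDT

open CDT

variable {P : PrimSig.{u, v}} {Γ : CDT.{u, v, w} P} {X : Option P.Srt → Type x} {E : RDT Γ X}
  {R : Set (Γ.TermPair X)}

theorem ACEqv.eqv {s : Option P.Srt} {t t' : Γ.Term X s} (h : E.ACEqv t t') : E.Eqv t t' :=
  EqTheory.mono (Set.image_mono fun _ he => he.1) h

/-- Induction principle for `=_AC`, with the instances of the equations made explicit. -/
theorem ACEqv.induct {p : {s : Option P.Srt} → Γ.Term X s → Γ.Term X s → Prop}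
    (comm : ∀ (C : Γ.Ctor) (s : Option P.Srt) (h : Γ.IsBin C s) (a b : Γ.Term X s), E.Com C →
      p (bin h a b) (bin h b a))
    (assoc : ∀ (C : Γ.Ctor) (h : Γ.IsBin C none) (a b c : Γ.Term X none), E.IsAC C →
      p (bin h a (bin h b c)) (bin h (bin h a b) c))
    (refl : ∀ (s : Option P.Srt) (t : Γ.Term X s), p t t)
    (symm : ∀ (s : Option P.Srt) (t t' : Γ.Term X s), p t t' → p t' t)
    (trans : ∀ (s : Option P.Srt) (t t' t'' : Γ.Term X s), p t t' → p t' t'' → p t t'')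
    (congr : ∀ (C : Γ.Ctor) (ts us : (i : Fin (Γ.arity C)) → Γ.Term X (Γ.dom C i)),
      (∀ i, p (ts i) (us i)) → p (Term.app C ts) (Term.app C us))
    {s : Option P.Srt} {t t' : Γ.Term X s} (h : E.ACEqv t t') : p t t' := by
  induction h with
  | inst l r θ hlr =>
    obtain ⟨e, ⟨he, C, hC, hCe⟩, heq⟩ := hlr
    obtain ⟨rfl, heq⟩ := Sigma.mk.inj_iff.1 heq
    cases eq_of_heq heq
    rcases hCe with ⟨s, h, y, z, -, e⟩ | hCe
    · obtain ⟨rfl, rfl⟩ := Prod.mk.inj e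
      simp only [Term.subst_bin]
      exact comm _ _ _ _ _ hC
    -- The associativity equation at hand is itself the witness that the commutative `C` is an
    -- AC-constructor.
    · have hAC : E.IsAC C := ⟨hC, _, he, hCe⟩
      obtain ⟨h, y, z, z', -, -, -, e | e⟩ := hCe
      · obtain ⟨rfl, rfl⟩ := Prod.mk.inj e
        simp only [Term.subst_bin]
        exact assoc _ _ _ _ _ hAC
      · obtain ⟨rfl, rfl⟩ := Prod.mk.inj e
        simp only [Term.subst_bin]
        exact symm _ _ _ (assoc _ _ _ _ _ hAC)
  | refl t => exact refl _ _
  | symm _ ih => exact symm _ _ _ ih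
  | trans _ _ ih ih' => exact trans _ _ _ _ ih ih'
  | congr C ts us _ ih => exact congr _ _ _ ih

/-- Both sides of a commutativity or associativity equation contain the same variables. This can
fail for `=_E`. -/
theorem ACEqv.vars_eq {s : Option P.Srt} {t t' : Γ.Term X s} (h : E.ACEqv t t') :
    t.vars = t'.vars := by
  refine ACEqv.induct (p := fun t t' => t.vars = t'.vars) ?_ ?_ ?_ ?_ ?_ ?_ h
  · intro C s h a b _
    rw [Term.vars_bin, Term.vars_bin, Set.union_comm]
  · intro C h a b c _
    simp only [Term.vars_bin, Set.union_assoc]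
  · exact fun _ _ => rfl
  · exact fun _ _ _ => Eq.symm
  · exact fun _ _ _ _ => Eq.trans
  · intro C ts us h
    simp only [Term.vars, h]

theorem ACEqv.ground_iff {s : Option P.Srt} {t t' : Γ.Term X s} (h : E.ACEqv t t') :
    t.Ground ↔ t'.Ground := by
  rw [Term.ground_iff_vars, Term.ground_iff_vars, h.vars_eq]

theorem Com.acEqv {C : Γ.Ctor} (hC : E.Com C) {s : Option P.Srt} (h : Γ.IsBin C s)
    (a b : Γ.Term X s) : E.ACEqv (bin h a b) (bin h b a) := by
  classical
  obtain ⟨e, he, s', h', y, z, hyz, rfl⟩ := id hC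
  obtain rfl := h'.sort_unique h
  -- The substitution sends `y` to `a` and, as `z ≠ y`, `z` to `b`.
  let θ : (s : Option P.Srt) → X s → Γ.Term X s :=
    Function.update (fun _ y => .var y) s' fun t => if t = y then a else b
  have := EqTheory.inst (A := Sigma.mk none '' E.acEqs) _ _ θ
    ⟨_, ⟨he, C, hC, Or.inl ⟨s', h', y, z, hyz, rfl⟩⟩, rfl⟩
  simpa [ACEqv, Term.subst_bin, Term.subst, θ, hyz.symm] using this

theorem IsAC.acEqv {C : Γ.Ctor} (hC : E.IsAC C) (h : Γ.IsBin C none) (a b c : Γ.Term X none) :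
    E.ACEqv (bin h a (bin h b c)) (bin h (bin h a b) c) := by
  classical
  obtain ⟨hCom, e, he, hA⟩ := id hC
  obtain ⟨h', y, z, z', h1, h2, h3, e'⟩ := id hA
  let θ : (s : Option P.Srt) → X s → Γ.Term X s :=
    Function.update (fun _ y => .var y) none fun t => if t = y then a else if t = z then b else c
  have := EqTheory.inst (A := Sigma.mk none '' E.acEqs) e.1 e.2 θ
    ⟨_, ⟨he, C, hCom, Or.inr hA⟩, rfl⟩
  -- `E` may contain the associativity equation in either direction; the second case is closed by
  -- symmetry.
  rcases e' with rfl | rfl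
  · simpa [ACEqv, Term.subst_bin, Term.subst, θ, h1.symm, h2.symm, h3.symm] using this
  · refine EqTheory.symm ?_
    simpa [Term.subst_bin, Term.subst, θ, h1.symm, h2.symm, h3.symm] using this

end RDT

/-! ### Renaming of variables. -/

namespace CDT.Term

variable {P : PrimSig.{u, v}} {Γ : CDT.{u, v, w} P} {X : Option P.Srt → Type x}

theorem subst_app_update (θ : (s : Option P.Srt) → X s → Γ.Term X s) (C : Γ.Ctor)
    (ts : (i : Fin (Γ.arity C)) → Γ.Term X (Γ.dom C i)) (i : Fin (Γ.arity C))
    (t : Γ.Term X (Γ.dom C i)) :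
    (app C (Function.update ts i t)).subst θ =
      app C (Function.update (fun j => (ts j).subst θ) i (t.subst θ)) := by
  simp only [subst]
  congr 1
  funext j
  exact Function.apply_update (fun _ t => subst θ t) ts i t j

/-- Renaming of the variables of a term. -/
def rename (σ : (s : Option P.Srt) → Equiv.Perm (X s)) {s : Option P.Srt} (t : Γ.Term X s) :
    Γ.Term X s :=
  t.subst fun s y => var (σ s y)

theorem rename_symm_rename (σ : (s : Option P.Srt) → Equiv.Perm (X s)) {s : Option P.Srt}
    (t : Γ.Term X s) : (t.rename σ).rename (fun s => (σ s).symm) = t := by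
  rw [rename, rename, subst_subst]
  simpa [subst] using subst_var t

theorem mem_vars_rename (σ : (s : Option P.Srt) → Equiv.Perm (X s)) {s s' : Option P.Srt}
    (t : Γ.Term X s) {y : X s'} (hy : ⟨s', y⟩ ∈ t.vars) : ⟨s', σ s' y⟩ ∈ (t.rename σ).vars := by
  rw [rename, vars_subst]
  exact Set.mem_biUnion hy rfl

end CDT.Term

namespace RDT

open CDT Relation

variable {P : PrimSig.{u, v}} {Γ : CDT.{u, v, w} P} {X : Option P.Srt → Type x} {E : RDT Γ X}
  {R : Set (Γ.TermPair X)}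

/-! ### Rewriting -/

theorem Rew.subst {s : Option P.Srt} {t t' : Γ.Term X s} (h : E.Rew R t t')
    (η : (s : Option P.Srt) → X s → Γ.Term X s) : E.Rew R (t.subst η) (t'.subst η) := by
  induction h with
  | root l r t θ hlr ht =>
    rw [Term.subst_subst]
    refine .root l r _ _ hlr ?_
    rw [← Term.subst_subst]
    exact EqTheory.subst ht η
  | arg C ts i t' _ ih =>
    rw [Term.subst_app_update]
    exact .arg C _ i _ ih

theorem Rew.eqTheory {s : Option P.Srt} {t t' : Γ.Term X s} (h : E.Rew R t t') :
    EqTheory (R ∪ Sigma.mk none '' E.acEqs) t t' := by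
  induction h with
  | root l r t θ hlr ht =>
    exact (ht.mono Set.subset_union_right).trans (.inst l r θ (Or.inl hlr))
  | arg C ts i t' _ ih =>
    refine .congr C _ _ fun j => ?_
    by_cases hj : j = i
    · subst hj; simpa using ih
    · simpa [hj] using EqTheory.refl _

/-- At the root the redex is only AC-equal to `l.subst θ`; AC-compatibility transfers the decrease
from the instance of the rule to the redex. -/
theorem Rew.gt {gt : {s : Option P.Srt} → Γ.Term X s → Γ.Term X s → Prop}
    (h₁ : IsReductionOrdering gt) (h₂ : E.ACCompatible gt)
    (h₃ : ∀ (s : Option P.Srt) (l r : Γ.Term X s), (⟨s, l, r⟩ : Γ.TermPair X) ∈ R → gt l r)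
    {s : Option P.Srt} {t t' : Γ.Term X s} (h : E.Rew R t t') : gt t t' := by
  induction h with
  | root l r t θ hlr ht =>
    exact (h₂ _ _ _ _ _ (EqTheory.symm ht) (EqTheory.refl _)).2 (h₁.subst _ _ _ θ (h₃ _ _ _ hlr))
  | arg C ts i t' _ ih => simpa using h₁.context C ts i _ _ ih

theorem IsCompletePresentation.wellFounded (hR : E.IsCompletePresentation R) (s : Option P.Srt) :
    WellFounded fun t t' : Γ.Term X s => E.Rew R t' t := by
  obtain ⟨gt, h₁, h₂, h₃⟩ := hR.ordered
  exact Subrelation.wf (fun h => Rew.gt h₁ h₂ h₃ h) (h₁.wf s)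

theorem IsNormal.eq_of_reflTransGen {s : Option P.Srt} {t t' : Γ.Term X s}
    (ht : E.IsNormal R t) (h : ReflTransGen (E.Rew R) t t') : t = t' := by
  rcases h.cases_head with h | ⟨t'', h, -⟩
  · exact h
  · exact (ht _ h).elim

theorem IsCompletePresentation.exists_normal (hR : E.IsCompletePresentation R)
    {s : Option P.Srt} (t : Γ.Term X s) :
    ∃ n, ReflTransGen (E.Rew R) t n ∧ E.IsNormal R n := by
  induction t using (hR.wellFounded s).induction with
  | _ t ih =>
    by_cases h : E.IsNormal R t
    · exact ⟨t, .refl, h⟩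
    · simp only [IsNormal, not_forall, not_not] at h
      obtain ⟨t', h⟩ := h
      obtain ⟨n, hn, hn'⟩ := ih t' h
      exact ⟨n, .head h hn, hn'⟩

/-- Normal forms have no proper reducts, so the joining terms given by confluence are `m` and `n`
themselves. -/
theorem IsCompletePresentation.acEqv_of_normal (hR : E.IsCompletePresentation R)
    {s : Option P.Srt} {a b m n : Γ.Term X s} (hab : E.ACEqv a b)
    (ha : ReflTransGen (E.Rew R) a m) (hb : ReflTransGen (E.Rew R) b n)
    (hm : E.IsNormal R m) (hn : E.IsNormal R n) : E.ACEqv m n := by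
  obtain ⟨c, d, hc, hd, hcd⟩ := hR.confluent _ _ _ _ _ hab ha hb
  rwa [hm.eq_of_reflTransGen hc, hn.eq_of_reflTransGen hd]

theorem reflTransGen_app (C : Γ.Ctor) (ts us : (i : Fin (Γ.arity C)) → Γ.Term X (Γ.dom C i))
    (h : ∀ i, ReflTransGen (E.Rew R) (ts i) (us i)) :
    ReflTransGen (E.Rew R) (Term.app C ts) (Term.app C us) := by
  classical
  have single : ∀ (ts : (i : Fin (Γ.arity C)) → Γ.Term X (Γ.dom C i)) (i : Fin (Γ.arity C))
      (t : Γ.Term X (Γ.dom C i)), ReflTransGen (E.Rew R) (ts i) t →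
      ReflTransGen (E.Rew R) (Term.app C ts) (Term.app C (Function.update ts i t)) := by
    intro ts i t ht
    induction ht with
    | refl => rw [Function.update_eq_self]
    | @tail b c _ hbc ih =>
      refine ih.tail ?_
      simpa using Rew.arg C (Function.update ts i b) i c (by simpa using hbc)
  -- Arguments are reduced one position at a time; `S` is the set of positions already reduced.
  have key : ∀ S : Finset (Fin (Γ.arity C)),
      ReflTransGen (E.Rew R) (Term.app C ts) (Term.app C (S.piecewise us ts)) := by
    intro S
    induction S using Finset.induction_on with
    | empty => rw [Finset.piecewise_empty]
    | insert i S hi ih =>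
      rw [Finset.piecewise_insert]
      exact ih.trans (single _ _ _ (by simpa [hi] using h i))
  simpa using key Finset.univ

/-- Terms that are equal in the theory of a complete presentation have AC-equal normal forms. -/
theorem IsCompletePresentation.church_rosser (hR : E.IsCompletePresentation R)
    {s : Option P.Srt} {t t' : Γ.Term X s}
    (h : EqTheory (R ∪ Sigma.mk none '' E.acEqs) t t') :
    ∃ n n', ReflTransGen (E.Rew R) t n ∧ ReflTransGen (E.Rew R) t' n' ∧ E.IsNormal R n ∧
      E.IsNormal R n' ∧ E.ACEqv n n' := by
  -- It is enough to reach AC-equal reducts: normalizing them further keeps AC-equality.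
  have ac : ∀ {s : Option P.Srt} {t t' a a' : Γ.Term X s}, ReflTransGen (E.Rew R) t a →
      ReflTransGen (E.Rew R) t' a' → E.ACEqv a a' →
      ∃ n n', ReflTransGen (E.Rew R) t n ∧ ReflTransGen (E.Rew R) t' n' ∧ E.IsNormal R n ∧
        E.IsNormal R n' ∧ E.ACEqv n n' := by
    intro s t t' a a' ht ht' h
    obtain ⟨n, hn, hn'⟩ := hR.exists_normal a
    obtain ⟨m, hm, hm'⟩ := hR.exists_normal a'
    exact ⟨n, m, ht.trans hn, ht'.trans hm, hn', hm', hR.acEqv_of_normal h hn hm hn' hm'⟩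
  induction h with
  | inst l r θ hlr =>
    rcases hlr with hlr | hlr
    · exact ac (.single (.root l r _ θ hlr (.refl _))) .refl (EqTheory.refl _)
    · exact ac .refl .refl (EqTheory.inst l r θ hlr)
  | refl t => exact ac .refl .refl (EqTheory.refl _)
  | symm _ ih =>
    obtain ⟨n, n', h₁, h₂, h₃, h₄, h₅⟩ := ih
    exact ⟨n', n, h₂, h₁, h₄, h₃, EqTheory.symm h₅⟩
  | trans _ _ ih ih' =>
    obtain ⟨n, n', h₁, h₂, h₃, h₄, h₅⟩ := ih
    obtain ⟨m, m', k₁, k₂, k₃, k₄, k₅⟩ := ih'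
    -- The middle term has two normal forms `n'` and `m`, which agree modulo AC.
    exact ⟨n, m', h₁, k₂, h₃, k₄, EqTheory.trans h₅
      (EqTheory.trans (hR.acEqv_of_normal (EqTheory.refl _) h₂ k₁ h₄ k₃) k₅)⟩
  | congr C ts us _ ih =>
    choose n n' h₁ h₂ _ _ h₅ using ih
    -- `C` applied to normal arguments may still be reducible, whence the further normalization
    -- inside `ac`.
    exact ac (reflTransGen_app C ts n h₁) (reflTransGen_app C us n' h₂) (EqTheory.congr C _ _ h₅)

/-- Strengthens `church_rosser` from some pair of normal forms to every pair, which is what an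
arbitrary `step` requires. -/
theorem IsCompletePresentation.acEqv_normal_of_eqv (hR : E.IsCompletePresentation R)
    {s : Option P.Srt} {t t' m m' : Γ.Term X s} (h : E.Eqv t t')
    (ht : ReflTransGen (E.Rew R) t m) (ht' : ReflTransGen (E.Rew R) t' m')
    (hm : E.IsNormal R m) (hm' : E.IsNormal R m') : E.ACEqv m m' := by
  obtain ⟨n, n', h₁, h₂, h₃, h₄, h₅⟩ := hR.church_rosser ((hR.same_theory _ _ _).1 h)
  exact EqTheory.trans (hR.acEqv_of_normal (EqTheory.refl _) ht h₁ hm h₃)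
    (EqTheory.trans h₅ (hR.acEqv_of_normal (EqTheory.refl _) h₂ ht' h₄ hm'))

theorem IsCompletePresentation.eqv_of_reflTransGen (hR : E.IsCompletePresentation R)
    {s : Option P.Srt} {t t' : Γ.Term X s} (h : ReflTransGen (E.Rew R) t t') : E.Eqv t t' := by
  induction h with
  | refl => exact EqTheory.refl _
  | tail _ h ih => exact EqTheory.trans ih ((hR.same_theory _ _ _).2 h.eqTheory)

/-- A step from the renamed term could be renamed back by `σ⁻¹` into a step from `t`. -/
theorem IsNormal.rename {s : Option P.Srt} {t : Γ.Term X s} (ht : E.IsNormal R t)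
    (σ : (s : Option P.Srt) → Equiv.Perm (X s)) : E.IsNormal R (t.rename σ) := by
  intro t' h
  have h' := h.subst fun s y => .var ((σ s).symm y)
  change E.Rew R ((t.rename σ).rename fun s => (σ s).symm) _ at h'
  rw [Term.rename_symm_rename] at h'
  exact ht _ h'

/-- The normal forms of a variable-free term are variable-free, even if the rules introduce
variables. -/
theorem IsCompletePresentation.ground_of_normal [∀ s, Infinite (X s)]
    (hR : E.IsCompletePresentation R) {s : Option P.Srt} {t n : Γ.Term X s} (ht : t.Ground)
    (h : ReflTransGen (E.Rew R) t n) (hn : E.IsNormal R n) : n.Ground := by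
  classical
  rw [Term.ground_iff_vars, Set.eq_empty_iff_forall_notMem]
  rintro ⟨s', y⟩ hy
  -- A fresh variable of the same sort exists since `n` has finitely many variables and `X s'` is
  -- infinite.
  obtain ⟨z, hz⟩ : ∃ z : X s', (⟨s', z⟩ : Σ s, X s) ∉ n.vars :=
    (n.finite_vars.preimage sigma_mk_injective.injOn).exists_notMem
  let σ : (s : Option P.Srt) → Equiv.Perm (X s) :=
    Function.update (fun _ => Equiv.refl _) s' (Equiv.swap y z)
  have hσ : σ s' y = z := by simp [σ]
  -- Renaming the whole derivation leaves its ground starting term fixed.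
  have h' : ReflTransGen (E.Rew R) t (n.rename σ) := by
    have : ReflTransGen (E.Rew R) (t.rename σ) (n.rename σ) := ReflTransGen.lift (fun t : Γ.Term X s => t.rename σ)
      (fun a b (hab : E.Rew R a b) => hab.subst _) _ _ h
    rwa [show t.rename σ = t from Term.subst_eq_self_of_ground _ ht] at this
  have hAC := hR.acEqv_of_normal (EqTheory.refl _) h h' hn (hn.rename σ)
  refine hz ?_
  rw [hAC.vars_eq, ← hσ]
  exact Term.mem_vars_rename σ n hy

/-! ### Iteration of `step`. -/

theorem reflTransGen_of_reaches {step : Γ.Term X none → Option (Γ.Term X none)}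
    (hs : E.IsStep R step) {t t' : Γ.Term X none} (h : StateTransition.Reaches step t t') :
    ReflTransGen (E.Rew R) t t' :=
  ReflTransGen.mono (fun a b hab => hs.rew a b hab) _ _ h

theorem IsCompletePresentation.exists_mem_norm (hR : E.IsCompletePresentation R)
    {step : Γ.Term X none → Option (Γ.Term X none)} (hs : E.IsStep R step) (t : Γ.Term X none) :
    ∃ n ∈ norm step t, ReflTransGen (E.Rew R) t n ∧ E.IsNormal R n := by
  have : ∃ n, StateTransition.Reaches step t n ∧ step n = none := by
    induction t using (hR.wellFounded none).induction with
    | _ t ih =>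
      cases h : step t with
      | none => exact ⟨t, .refl, h⟩
      | some t' =>
        obtain ⟨n, hn, hn'⟩ := ih t' (hs.rew _ _ h)
        exact ⟨n, .head h hn, hn'⟩
  obtain ⟨n, hn, hn'⟩ := this
  exact ⟨n, StateTransition.mem_eval.2 ⟨hn, hn'⟩, reflTransGen_of_reaches hs hn,
    hs.normal _ hn'⟩

theorem exists_isStep (E : RDT Γ X) (R : Set (Γ.TermPair X)) : ∃ step, E.IsStep R step := by
  classical
  refine ⟨fun t => if h : ∃ t', E.Rew R t t' then some h.choose else none, ?_, ?_⟩
  · intro t t' h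
    split_ifs at h with h'
    cases h
    exact h'.choose_spec
  · intro t h t' h'
    rw [dif_pos ⟨t', h'⟩] at h
    cases h

end RDT

namespace RDT

open CDT

variable {P : PrimSig.{u, v}} {Γ : CDT.{u, v, w} P} {X : Option P.Srt → Type x} {E : RDT Γ X}
  {C : Γ.Ctor} (h : Γ.IsBin C none) {orient : Γ.Ctor → Side}

/-! ### Combs and their leaves -/

theorem headedBy_bin (a b : Γ.Term X none) : (bin h a b).HeadedBy C := ⟨_, rfl⟩

theorem leaves_eq_singleton (o : Side) {t : Γ.Term X none} (ht : ¬ t.HeadedBy C) :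
    leaves o h t = [t] := by
  have key : ∀ (s : Option P.Srt) (t : Γ.Term X s) (e : s = none),
      ¬ Term.HeadedBy C (e ▸ t : Γ.Term X none) → leaves o h t = [t] := by
    intro s t e ht
    cases t with
    | var y => rw [leaves]
    | const c => cases e
    | app D ts =>
      rw [leaves]
      split_ifs with hD
      · subst hD
        exact (ht ⟨ts, rfl⟩).elim
      · rfl
  exact key none t rfl ht

theorem leaves_app (o : Side) (ts : (i : Fin (Γ.arity C)) → Γ.Term X (Γ.dom C i)) :
    leaves o h (Term.app C ts) = match o with
      | .right => h.arg ts h.pos₀ :: leaves o h (h.arg ts h.pos₁)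
      | .left => leaves o h (h.arg ts h.pos₀) ++ [h.arg ts h.pos₁] := by
  have hl : ∀ i, leaves o h (h.arg ts i) = h.dom_eq i ▸ leaves o h (ts i) := fun i =>
    apply_cast (F := fun s => Γ.Term X s) (G := fun s => List (Γ.Term X s))
      (fun _ t => leaves o h t) (h.dom_eq i) (ts i)
  rw [leaves, dif_pos rfl]
  cases o
  · simp only [hl]; rfl
  · simp only [hl]; rfl

@[simp] theorem leaves_right_bin (a b : Γ.Term X none) :
    leaves .right h (bin h a b) = a :: leaves .right h b := by
  rw [bin_eq_app, leaves_app]; simp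

@[simp] theorem leaves_left_bin (a b : Γ.Term X none) :
    leaves .left h (bin h a b) = leaves .left h a ++ [b] := by
  rw [bin_eq_app, leaves_app]; simp

/-- Ensures that the dummy value of `mkComb` is never returned on a list of leaves. -/
theorem leaves_ne_nil (o : Side) (t : Γ.Term X none) : leaves o h t ≠ [] := by
  induction t using Term.binInduction h with
  | leaf t ht => simp [leaves_eq_singleton h o ht]
  | node a b _ _ => cases o <;> simp

@[simp] theorem mkComb_singleton (o : Side) (d a : Γ.Term X none) : mkComb o h d [a] = a := by
  cases o <;> rfl

theorem mkComb_right_cons (d d' a : Γ.Term X none) {l : List (Γ.Term X none)} (hl : l ≠ []) :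
    mkComb .right h d (a :: l) = bin h a (mkComb .right h d' l) := by
  cases l with
  | nil => exact (hl rfl).elim
  | cons b l => rfl

/-- `leftComb` accumulates from the front, whereas the root of a left comb splits off the last leaf.
-/
theorem leftComb_concat (a b : Γ.Term X none) (l : List (Γ.Term X none)) :
    leftComb h a (l ++ [b]) = bin h (leftComb h a l) b := by
  induction l generalizing a with
  | nil => rfl
  | cons c l ih => exact ih _

theorem mkComb_left_concat (d d' a : Γ.Term X none) {l : List (Γ.Term X none)} (hl : l ≠ []) :
    mkComb .left h d (l ++ [a]) = bin h (mkComb .left h d' l) a := by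
  cases l with
  | nil => exact (hl rfl).elim
  | cons b l => exact leftComb_concat h b a l

/-- Induction on the leaves of a comb. -/
theorem comb_induction {p : Side → List (Γ.Term X none) → Prop} (single : ∀ o a, p o [a])
    (right : ∀ a l, l ≠ [] → p .right l → p .right (a :: l))
    (left : ∀ a l, l ≠ [] → p .left l → p .left (l ++ [a])) (o : Side)
    {l : List (Γ.Term X none)} (hl : l ≠ []) : p o l := by
  cases o with
  | right =>
    induction l with
    | nil => exact (hl rfl).elim
    | cons a l ih =>
      by_cases h : l = []
      · subst h; exact single _ _
      · exact right _ _ h (ih h)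
  | left =>
    induction l using List.reverseRecOn with
    | nil => exact (hl rfl).elim
    | append_singleton l a ih =>
      by_cases h : l = []
      · subst h; exact single _ _
      · exact left _ _ h (ih h)

/-- Valid even when `t` is not a comb: `leaves` follows only one spine and keeps every side argument
whole. -/
theorem mkComb_leaves (o : Side) (d t : Γ.Term X none) : mkComb o h d (leaves o h t) = t := by
  induction t using Term.binInduction h with
  | leaf t ht => simp [leaves_eq_singleton h o ht]
  | node a b iha ihb =>
    cases o
    · rw [leaves_left_bin, mkComb_left_concat h d d _ (leaves_ne_nil h _ _), iha]
    · rw [leaves_right_bin, mkComb_right_cons h d d _ (leaves_ne_nil h _ _), ihb]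

/-- The head condition prevents the element at the end of the spine from being split into further
leaves. -/
theorem leaves_mkComb (o : Side) (d : Γ.Term X none) {l : List (Γ.Term X none)} (hl : l ≠ [])
    (hC : ∀ t ∈ l, ¬ t.HeadedBy C) : leaves o h (mkComb o h d l) = l := by
  revert hC
  refine comb_induction (p := fun o l => (∀ t ∈ l, ¬ t.HeadedBy C) →
    leaves o h (mkComb o h d l) = l) ?_ ?_ ?_ o hl
  · intro o a ha
    simpa using leaves_eq_singleton h o (ha a (by simp))
  · intro a l hl ih hC
    rw [mkComb_right_cons h d d _ hl, leaves_right_bin, ih fun t ht => hC t (by simp [ht])]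
  · intro a l hl ih hC
    rw [mkComb_left_concat h d d _ hl, leaves_left_bin, ih fun t ht => hC t (by simp [ht])]

theorem headedBy_mkComb (o : Side) (d : Γ.Term X none) {l : List (Γ.Term X none)}
    (hl : 2 ≤ l.length) : (mkComb o h d l).HeadedBy C := by
  have hne : l ≠ [] := by rintro rfl; simp at hl
  refine comb_induction (p := fun o l => 2 ≤ l.length → (mkComb o h d l).HeadedBy C)
    ?_ ?_ ?_ o hne hl
  · intro o a ha; simp at ha
  · intro a l hl _ _
    rw [mkComb_right_cons h d d _ hl]
    exact headedBy_bin h _ _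
  · intro a l hl _ _
    rw [mkComb_left_concat h d d _ hl]
    exact headedBy_bin h _ _

theorem isComb_mkComb (o : Side) (d : Γ.Term X none) {l : List (Γ.Term X none)} (hl : l ≠ [])
    (hC : ∀ t ∈ l, ¬ t.HeadedBy C) : IsComb h o (mkComb o h d l) l := by
  revert hC
  refine comb_induction (p := fun o l => (∀ t ∈ l, ¬ t.HeadedBy C) →
    IsComb h o (mkComb o h d l) l) ?_ ?_ ?_ o hl
  · intro o a ha
    simpa using IsComb.single o a (ha a (by simp))
  · intro a l hl ih hC
    rw [mkComb_right_cons h d d _ hl]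
    exact .right _ _ _ (hC a (by simp)) (ih fun t ht => hC t (by simp [ht]))
  · intro a l hl ih hC
    rw [mkComb_left_concat h d d _ hl]
    exact .left _ _ _ (hC a (by simp)) (ih fun t ht => hC t (by simp [ht]))

/-! ### The functions `comb` and `sort` on binary constructors -/

theorem comb_app_of_not_isAC {D : Γ.Ctor} (hD : ¬ E.IsAC D)
    (ts : (i : Fin (Γ.arity D)) → Γ.Term X (Γ.dom D i)) :
    comb E orient (Term.app D ts) = Term.app D fun i => comb E orient (ts i) := by
  rw [comb, dif_neg hD]

theorem comb_app (hC : E.IsAC C) (d : Γ.Term X none)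
    (ts : (i : Fin (Γ.arity C)) → Γ.Term X (Γ.dom C i)) :
    comb E orient (Term.app C ts) = mkComb (orient C) h d
      (leaves (orient C) h (comb E orient (h.arg ts h.pos₀)) ++
        leaves (orient C) h (comb E orient (h.arg ts h.pos₁))) := by
  have hl : ∀ i, leaves (orient C) h (comb E orient (h.arg ts i)) =
      h.dom_eq i ▸ leaves (orient C) h (comb E orient (ts i)) := fun i =>
    apply_cast (F := fun s => Γ.Term X s) (G := fun s => List (Γ.Term X s))
      (fun _ t => leaves (orient C) h (comb E orient t)) (h.dom_eq i) (ts i)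
  -- On non-empty lists the dummy is irrelevant, so `d` may replace the one fixed in the definition
  -- of `comb`.
  have hd : ∀ (d d' : Γ.Term X none) (l : List (Γ.Term X none)), l ≠ [] →
      mkComb (orient C) h d l = mkComb (orient C) h d' l := by
    intro d d' l hl
    cases l with
    | nil => exact (hl rfl).elim
    | cons a l => rfl
  rw [hd d (Term.app C fun i => comb E orient (ts i)) _ (by simp [leaves_ne_nil]), hl, hl, comb,
    dif_pos hC]

theorem comb_bin (hC : E.IsAC C) (d a b : Γ.Term X none) :
    comb E orient (bin h a b) = mkComb (orient C) h d
      (leaves (orient C) h (comb E orient a) ++ leaves (orient C) h (comb E orient b)) := by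
  rw [bin_eq_app, comb_app h hC d, h.arg_binArgs₀, h.arg_binArgs₁]

theorem headedBy_comb {D : Γ.Ctor} {t : Γ.Term X none} (hD : t.HeadedBy D) :
    (comb E orient t).HeadedBy D := by
  obtain ⟨ts, rfl⟩ := hD
  by_cases hAC : E.IsAC D
  · rw [comb_app hAC.isBin hAC (Term.app D ts)]
    refine headedBy_mkComb _ _ _ ?_
    have h := fun t : Γ.Term X none =>
      List.length_pos_iff.2 (leaves_ne_nil hAC.isBin (orient D) t)
    rw [List.length_append]
    exact Nat.add_le_add (h _) (h _)
  · rw [comb_app_of_not_isAC hAC]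
    exact ⟨_, rfl⟩

theorem headedBy_unique {D D' : Γ.Ctor} {t : Γ.Term X none} (hD : t.HeadedBy D)
    (hD' : t.HeadedBy D') : D = D' := by
  obtain ⟨ts, rfl⟩ := hD
  obtain ⟨us, e⟩ := hD'
  cases e
  rfl

theorem var_or_headedBy (t : Γ.Term X none) : (∃ y, t = .var y) ∨ ∃ D, t.HeadedBy D := by
  have key : ∀ (s : Option P.Srt) (t : Γ.Term X s) (e : s = none),
      (∃ y, (e ▸ t : Γ.Term X none) = .var y) ∨ ∃ D, Term.HeadedBy D (e ▸ t : Γ.Term X none) := by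
    intro s t e
    cases t with
    | var y => subst e; exact Or.inl ⟨y, rfl⟩
    | const c => cases e
    | app D ts => exact Or.inr ⟨D, ts, rfl⟩
  exact key none t rfl

theorem not_headedBy_var (y : X none) : ¬ (Term.var y : Γ.Term X none).HeadedBy C := by
  rintro ⟨ts, e⟩
  cases e

/-- A term of sort `none` is a variable or headed by a unique constructor, so a map preserving both
cases cannot create a new head `C`. -/
theorem not_headedBy_of_preserves {f : Γ.Term X none → Γ.Term X none}
    (hv : ∀ y, f (.var y) = .var y) (hf : ∀ D t, t.HeadedBy D → (f t).HeadedBy D)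
    {t : Γ.Term X none} (ht : ¬ t.HeadedBy C) : ¬ (f t).HeadedBy C := by
  rcases var_or_headedBy t with ⟨y, rfl⟩ | ⟨D, hD⟩
  · rw [hv]; exact not_headedBy_var y
  · intro h
    exact ht (headedBy_unique h (hf D t hD) ▸ hD)

theorem not_headedBy_comb {t : Γ.Term X none} (ht : ¬ t.HeadedBy C) :
    ¬ (comb E orient t).HeadedBy C :=
  not_headedBy_of_preserves (fun _ => by rw [comb]) (fun _ _ => headedBy_comb) ht

/-- `comb` flattens completely: the leaves of both arguments are spliced together, and by induction
none of them hides another `C`. -/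
theorem not_headedBy_of_mem_leaves_comb (hC : E.IsAC C) (t : Γ.Term X none) :
    ∀ u ∈ leaves (orient C) h (comb E orient t), ¬ u.HeadedBy C := by
  induction t using Term.binInduction h with
  | leaf t ht =>
    rw [leaves_eq_singleton h _ (not_headedBy_comb ht)]
    simpa using not_headedBy_comb ht
  | node a b iha ihb =>
    have key : ∀ u ∈ leaves (orient C) h (comb E orient a) ++ leaves (orient C) h (comb E orient b),
        ¬ u.HeadedBy C := by
      intro u hu
      exact (List.mem_append.1 hu).elim (iha u) (ihb u)
    rw [comb_bin h hC a, leaves_mkComb h _ _ (by simp [leaves_ne_nil]) key]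
    exact key

theorem leaves_comb_bin (hC : E.IsAC C) (a b : Γ.Term X none) :
    leaves (orient C) h (comb E orient (bin h a b)) =
      leaves (orient C) h (comb E orient a) ++ leaves (orient C) h (comb E orient b) := by
  rw [comb_bin h hC a, leaves_mkComb h _ _ (by simp [leaves_ne_nil])]
  intro u hu
  exact (List.mem_append.1 hu).elim (not_headedBy_of_mem_leaves_comb h hC a u)
    (not_headedBy_of_mem_leaves_comb h hC b u)

/-- Repeated associativity, by induction on the list away from the end of the spine: `l` for right
combs, `l'` from its last element for left combs. -/
theorem acEqv_mkComb_append (hC : E.IsAC C) (o : Side) (d d₁ d₂ : Γ.Term X none)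
    {l l' : List (Γ.Term X none)} (hl : l ≠ []) (hl' : l' ≠ []) :
    E.ACEqv (mkComb o h d (l ++ l')) (bin h (mkComb o h d₁ l) (mkComb o h d₂ l')) := by
  cases o with
  | right =>
    induction l with
    | nil => exact (hl rfl).elim
    | cons a l ih =>
      by_cases h' : l = []
      · subst h'
        rw [List.singleton_append, mkComb_right_cons h d d₂ a hl', mkComb_singleton]
        exact EqTheory.refl _
      · rw [List.cons_append, mkComb_right_cons h d d a (by simp [h']),
          mkComb_right_cons h d₁ d₁ a h']
        exact EqTheory.trans (EqTheory.bin h (EqTheory.refl _) (ih h')) (hC.acEqv h _ _ _)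
  | left =>
    induction l' using List.reverseRecOn with
    | nil => exact (hl' rfl).elim
    | append_singleton l' a ih =>
      by_cases h' : l' = []
      · subst h'
        rw [List.nil_append, mkComb_left_concat h d d₁ a hl, mkComb_singleton]
        exact EqTheory.refl _
      · rw [← List.append_assoc, mkComb_left_concat h d d a (by simp [h']),
          mkComb_left_concat h d₂ d₂ a h']
        exact EqTheory.trans (EqTheory.bin h (ih h') (EqTheory.refl _))
          (EqTheory.symm (hC.acEqv h _ _ _))

theorem acEqv_mkComb_cons (hC : E.IsAC C) (o : Side) (d d' a : Γ.Term X none)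
    {l : List (Γ.Term X none)} (hl : l ≠ []) :
    E.ACEqv (mkComb o h d (a :: l)) (bin h a (mkComb o h d' l)) := by
  simpa using acEqv_mkComb_append h hC o d d d' (l := [a]) (by simp) hl

theorem acEqv_mkComb_perm (hC : E.IsAC C) (o : Side) (d d' : Γ.Term X none)
    {l l' : List (Γ.Term X none)} (hl : l ≠ []) (hp : l.Perm l') :
    E.ACEqv (mkComb o h d l) (mkComb o h d' l') := by
  induction hp generalizing d d' with
  | nil => exact (hl rfl).elim
  | @cons a l l' hp ih =>
    by_cases h' : l = []
    · subst h'
      cases hp.nil_eq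
      simp only [mkComb_singleton]
      exact EqTheory.refl a
    · have h'' : l' ≠ [] := fun e => h' (by subst e; exact hp.eq_nil)
      exact EqTheory.trans (acEqv_mkComb_cons h hC o d d a h') (EqTheory.trans
        (EqTheory.bin h (EqTheory.refl _) (ih d d h'))
        (EqTheory.symm (acEqv_mkComb_cons h hC o d' d a h'')))
  -- The two leaves are exchanged by commutativity in isolation, then the remaining ones are
  -- appended by re-association.
  | swap a b l =>
    have key : ∀ d a b, E.ACEqv (mkComb o h d [a, b]) (bin h a b) := fun d a b => by
      simpa using acEqv_mkComb_cons h hC o d d a (l := [b]) (by simp)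
    have hab : E.ACEqv (mkComb o h d [b, a]) (mkComb o h d' [a, b]) :=
      EqTheory.trans (key d b a) (EqTheory.trans (hC.1.acEqv h b a) (EqTheory.symm (key d' a b)))
    by_cases h' : l = []
    · subst h'
      exact hab
    · exact EqTheory.trans (acEqv_mkComb_append h hC o d d d (l := [b, a]) (by simp) h')
        (EqTheory.trans (EqTheory.bin h hab (EqTheory.refl _))
          (EqTheory.symm (acEqv_mkComb_append h hC o d' d' d (l := [a, b]) (by simp) h')))
  | trans hp _ ih ih' =>
    exact EqTheory.trans (ih d d hl) (ih' d d' fun e => hl (by subst e; exact hp.eq_nil))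

theorem acEqv_comb {s : Option P.Srt} (t : Γ.Term X s) : E.ACEqv (comb E orient t) t := by
  induction t with
  | var y => rw [comb]; exact EqTheory.refl _
  | const c => rw [comb]; exact EqTheory.refl _
  | app D ts ih =>
    by_cases hD : E.IsAC D
    · have hb := hD.isBin
      have ih' := fun i =>
        (prop_arg hb (p := fun t => E.ACEqv (comb E orient t) t) (ts := ts) i).2 (ih i)
      rw [comb_app hb hD (Term.app D ts)]
      conv => arg 3; rw [app_eq_bin hb]
      refine EqTheory.trans (acEqv_mkComb_append hb hD _ _ (Term.app D ts) (Term.app D ts)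
        (leaves_ne_nil _ _ _) (leaves_ne_nil _ _ _)) ?_
      rw [mkComb_leaves, mkComb_leaves]
      exact EqTheory.bin hb (ih' _) (ih' _)
    · rw [comb_app_of_not_isAC hD]
      exact EqTheory.congr D _ _ ih

/-! ### Subterms -/

theorem subterm_bin_left {D : Γ.Ctor} {s : Option P.Srt} (h : Γ.IsBin D s) (a b : Γ.Term X s)
    {s' : Option P.Srt} {t : Γ.Term X s'} (ht : t.Subterm a) : t.Subterm (bin h a b) := by
  refine .arg _ (binArgs h a b) h.pos₀ ?_
  rwa [← prop_arg h (p := fun u => t.Subterm u), h.arg_binArgs₀]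

theorem subterm_bin_right {D : Γ.Ctor} {s : Option P.Srt} (h : Γ.IsBin D s) (a b : Γ.Term X s)
    {s' : Option P.Srt} {t : Γ.Term X s'} (ht : t.Subterm b) : t.Subterm (bin h a b) := by
  refine .arg _ (binArgs h a b) h.pos₁ ?_
  rwa [← prop_arg h (p := fun u => t.Subterm u), h.arg_binArgs₁]

theorem subterm_trans {s s' s'' : Option P.Srt} {t : Γ.Term X s} {t' : Γ.Term X s'}
    {t'' : Γ.Term X s''} (ht : t.Subterm t') (ht' : t'.Subterm t'') : t.Subterm t'' := by
  induction ht' with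
  | refl => exact ht
  | arg C ts i _ ih => exact .arg C ts i ih

theorem subterm_of_mem_leaves (o : Side) (t : Γ.Term X none) :
    ∀ u ∈ leaves o h t, u.Subterm t := by
  induction t using Term.binInduction h with
  | leaf t ht =>
    rw [leaves_eq_singleton h o ht]
    rintro u hu
    obtain rfl := List.mem_singleton.1 hu
    exact .refl
  | node a b iha ihb =>
    intro u hu
    cases o
    · rw [leaves_left_bin, List.mem_append, List.mem_singleton] at hu
      rcases hu with hu | rfl
      · exact subterm_bin_left h a b (iha u hu)
      · exact subterm_bin_right h a u .refl
    · rw [leaves_right_bin, List.mem_cons] at hu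
      rcases hu with rfl | hu
      · exact subterm_bin_left h u b .refl
      · exact subterm_bin_right h a b (ihb u hu)

/-! ### Sorting of leaves and arguments. -/

section LinearOrder

variable [∀ s, LinearOrder (Γ.Term X s)]

theorem sort_app_of_isAC (hC : E.IsAC C) (d : Γ.Term X none)
    (ts : (i : Fin (Γ.arity C)) → Γ.Term X (Γ.dom C i)) :
    sort E orient (Term.app C ts) = mkComb (orient C) h d
      ((leaves (orient C) h (Term.app C fun i => sort E orient (ts i))).insertionSort (· ≤ ·)) := by
  rw [sort, dif_pos hC]
  cases hl : (leaves (orient C) h (Term.app C fun i => sort E orient (ts i))).insertionSort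
    (· ≤ ·) with
  | nil =>
    have := (List.perm_insertionSort (· ≤ ·) _).symm.trans (List.Perm.of_eq hl)
    exact (leaves_ne_nil _ _ _ this.eq_nil).elim
  | cons a l => rfl

theorem sort_bin_of_isAC (hC : E.IsAC C) (d a b : Γ.Term X none) :
    sort E orient (bin h a b) = mkComb (orient C) h d
      ((leaves (orient C) h (bin h (sort E orient a) (sort E orient b))).insertionSort
        (· ≤ ·)) := by
  rw [bin_eq_app, sort_app_of_isAC h hC d, app_eq_bin h, h.arg_map (fun t => sort E orient t),
    h.arg_map (fun t => sort E orient t), h.arg_binArgs₀, h.arg_binArgs₁]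

theorem sort_app_of_com (hC : E.Com C) (hA : ¬ E.IsAC C) {s : Option P.Srt} (h : Γ.IsBin C s)
    (ts : (i : Fin (Γ.arity C)) → Γ.Term X (Γ.dom C i)) :
    sort E orient (Term.app C ts) =
      bin h (min (sort E orient (h.arg ts h.pos₀)) (sort E orient (h.arg ts h.pos₁)))
        (max (sort E orient (h.arg ts h.pos₀)) (sort E orient (h.arg ts h.pos₁))) := by
  rw [sort, dif_neg hA, dif_pos hC]
  -- The definition of `sort` uses a chosen argument sort; uniqueness of that sort allows any other
  -- witness.
  have key : ∀ {s s' : Option P.Srt} (h : Γ.IsBin C s) (h' : Γ.IsBin C s'),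
      (bin h (min (h.arg (fun i => sort E orient (ts i)) h.pos₀)
          (h.arg (fun i => sort E orient (ts i)) h.pos₁))
        (max (h.arg (fun i => sort E orient (ts i)) h.pos₀)
          (h.arg (fun i => sort E orient (ts i)) h.pos₁)) : Γ.Term X none) =
      bin h' (min (h'.arg (fun i => sort E orient (ts i)) h'.pos₀)
          (h'.arg (fun i => sort E orient (ts i)) h'.pos₁))
        (max (h'.arg (fun i => sort E orient (ts i)) h'.pos₀)
          (h'.arg (fun i => sort E orient (ts i)) h'.pos₁)) := by
    intro s s' h h'
    obtain rfl := h.sort_unique h'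
    rfl
  refine (key _ h).trans ?_
  simp only [h.arg_map (fun t => sort E orient t)]

theorem sort_app_of_not_com (hC : ¬ E.Com C)
    (ts : (i : Fin (Γ.arity C)) → Γ.Term X (Γ.dom C i)) :
    sort E orient (Term.app C ts) = Term.app C fun i => sort E orient (ts i) := by
  rw [sort, dif_neg fun h => hC h.1, dif_neg hC]

theorem insertionSort_ne_nil {s : Option P.Srt} {l : List (Γ.Term X s)} (hl : l ≠ []) :
    l.insertionSort (· ≤ ·) ≠ [] := fun e =>
  hl ((List.perm_insertionSort (· ≤ ·) l).symm.trans (List.Perm.of_eq e)).eq_nil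

theorem insertionSort_eq_of_perm {s : Option P.Srt} {l l' : List (Γ.Term X s)} (hp : l.Perm l') :
    l.insertionSort (· ≤ ·) = l'.insertionSort (· ≤ ·) :=
  List.Perm.eq_of_pairwise' (List.pairwise_insertionSort _ _) (List.pairwise_insertionSort _ _)
    (((List.perm_insertionSort _ _).trans hp).trans (List.perm_insertionSort _ _).symm)

theorem headedBy_sort {D : Γ.Ctor} {t : Γ.Term X none} (hD : t.HeadedBy D) :
    (sort E orient t).HeadedBy D := by
  obtain ⟨ts, rfl⟩ := hD
  by_cases hAC : E.IsAC D
  · have hb := hAC.isBin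
    rw [sort_app_of_isAC hb hAC (Term.app D ts)]
    refine headedBy_mkComb hb _ _ ?_
    rw [List.length_insertionSort, app_eq_bin hb]
    cases orient D
    · simpa [Nat.one_le_iff_ne_zero] using leaves_ne_nil hb .left _
    · simpa [Nat.one_le_iff_ne_zero] using leaves_ne_nil hb .right _
  · by_cases hCom : E.Com D
    · obtain ⟨s, hb⟩ := hCom.exists_isBin
      rw [sort_app_of_com hCom hAC hb]
      exact ⟨_, rfl⟩
    · rw [sort_app_of_not_com hCom]
      exact ⟨_, rfl⟩

theorem not_headedBy_sort {t : Γ.Term X none} (ht : ¬ t.HeadedBy C) :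
    ¬ (sort E orient t).HeadedBy C :=
  not_headedBy_of_preserves (fun _ => by rw [sort]) (fun _ _ => headedBy_sort) ht

/-- `sort` re-sorts at every node of the spine. Since sorted leaves are still not headed by `C`,
each pass sees exactly the expected leaves, and the nested sorts amount to a single one. -/
theorem sort_mkComb (hC : E.IsAC C) (d d' : Γ.Term X none) {l : List (Γ.Term X none)}
    (hl : l ≠ []) (hl' : ∀ t ∈ l, ¬ t.HeadedBy C) :
    sort E orient (mkComb (orient C) h d l) =
      mkComb (orient C) h d' ((l.map fun t => sort E orient t).insertionSort (· ≤ ·)) := by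
  have leaves_eq : ∀ {l : List (Γ.Term X none)}, l ≠ [] → (∀ t ∈ l, ¬ t.HeadedBy C) →
      leaves (orient C) h (mkComb (orient C) h d'
        ((l.map fun t => sort E orient t).insertionSort (· ≤ ·))) =
      (l.map fun t => sort E orient t).insertionSort (· ≤ ·) := by
    intro l hl hl'
    refine leaves_mkComb h _ _ (insertionSort_ne_nil (by simpa using hl)) ?_
    intro t ht
    rw [List.mem_insertionSort, List.mem_map] at ht
    obtain ⟨u, hu, rfl⟩ := ht
    exact not_headedBy_sort (hl' u hu)
  have bin_eq := fun a b => sort_bin_of_isAC (orient := orient) h hC d' a b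
  generalize ho : orient C = o
  revert ho hl'
  refine comb_induction (p := fun o l => (∀ t ∈ l, ¬ t.HeadedBy C) → orient C = o →
    sort E orient (mkComb o h d l) =
      mkComb o h d' ((l.map fun t => sort E orient t).insertionSort (· ≤ ·))) ?_ ?_ ?_ o hl
  · intro o a _ _
    simp
  · intro a l hl ih hl' ho
    have hl'' : ∀ t ∈ l, ¬ t.HeadedBy C := fun t ht => hl' t (by simp [ht])
    rw [ho] at leaves_eq bin_eq
    rw [mkComb_right_cons h d d a hl, bin_eq, leaves_right_bin, ih hl'' ho, leaves_eq hl hl'']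
    congr 1
    exact insertionSort_eq_of_perm ((List.perm_insertionSort _ _).cons _)
  · intro a l hl ih hl' ho
    have hl'' : ∀ t ∈ l, ¬ t.HeadedBy C := fun t ht => hl' t (by simp [ht])
    rw [ho] at leaves_eq bin_eq
    rw [mkComb_left_concat h d d a hl, bin_eq, leaves_left_bin, ih hl'' ho, leaves_eq hl hl'',
      List.map_append]
    congr 1
    exact insertionSort_eq_of_perm ((List.perm_insertionSort _ _).append_right _)

theorem acEqv_sort {s : Option P.Srt} (t : Γ.Term X s) : E.ACEqv (sort E orient t) t := by
  induction t with
  | var y => rw [sort]; exact EqTheory.refl _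
  | const c => rw [sort]; exact EqTheory.refl _
  | app D ts ih =>
    by_cases hD : E.IsAC D
    · rw [sort_app_of_isAC hD.isBin hD (Term.app D ts)]
      refine EqTheory.trans (acEqv_mkComb_perm _ hD _ _ (Term.app D ts)
        (insertionSort_ne_nil (leaves_ne_nil _ _ _)) (List.perm_insertionSort _ _)) ?_
      rw [mkComb_leaves]
      exact EqTheory.congr D _ _ ih
    · by_cases hCom : E.Com D
      · obtain ⟨s, hb⟩ := hCom.exists_isBin
        have ih' := fun i =>
          (prop_arg hb (p := fun t => E.ACEqv (sort E orient t) t) (ts := ts) i).2 (ih i)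
        rw [sort_app_of_com hCom hD hb]
        conv => arg 3; rw [app_eq_bin hb]
        rcases le_total (sort E orient (hb.arg ts hb.pos₀)) (sort E orient (hb.arg ts hb.pos₁))
          with hle | hle
        · rw [min_eq_left hle, max_eq_right hle]
          exact EqTheory.bin hb (ih' _) (ih' _)
        · rw [min_eq_right hle, max_eq_left hle]
          exact EqTheory.trans (hCom.acEqv hb _ _) (EqTheory.bin hb (ih' _) (ih' _))
      · rw [sort_app_of_not_com hCom]
        exact EqTheory.congr D _ _ ih

/-! ### The canonical form `sort (comb t)` -/

theorem leaves_sort_comb (hC : E.IsAC C) (t : Γ.Term X none) :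
    leaves (orient C) h (sort E orient (comb E orient t)) =
      ((leaves (orient C) h (comb E orient t)).map fun t => sort E orient t).insertionSort
        (· ≤ ·) := by
  have hn := not_headedBy_of_mem_leaves_comb (orient := orient) h hC t
  conv_lhs => rw [← mkComb_leaves h (orient C) t (comb E orient t),
    sort_mkComb h hC t t (leaves_ne_nil _ _ _) hn]
  refine leaves_mkComb h _ _ (insertionSort_ne_nil (by simpa using leaves_ne_nil h _ _)) ?_
  intro u hu
  rw [List.mem_insertionSort, List.mem_map] at hu
  obtain ⟨u, hu, rfl⟩ := hu
  exact not_headedBy_sort (hn u hu)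

theorem not_headedBy_of_mem_leaves_sort_comb (hC : E.IsAC C) (t : Γ.Term X none) :
    ∀ u ∈ leaves (orient C) h (sort E orient (comb E orient t)), ¬ u.HeadedBy C := by
  intro u hu
  rw [leaves_sort_comb h hC, List.mem_insertionSort, List.mem_map] at hu
  obtain ⟨u, hu, rfl⟩ := hu
  exact not_headedBy_sort (not_headedBy_of_mem_leaves_comb h hC t u hu)

theorem leaves_sort_comb_bin (hC : E.IsAC C) (a b : Γ.Term X none) :
    leaves (orient C) h (sort E orient (comb E orient (bin h a b))) =
      (leaves (orient C) h (sort E orient (comb E orient a)) ++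
        leaves (orient C) h (sort E orient (comb E orient b))).insertionSort (· ≤ ·) := by
  rw [leaves_sort_comb h hC, leaves_comb_bin h hC, leaves_sort_comb h hC, leaves_sort_comb h hC,
    List.map_append]
  exact insertionSort_eq_of_perm
    ((List.perm_insertionSort _ _).append (List.perm_insertionSort _ _)).symm

/-- The leaves of a canonical form are already sorted, so their multiset determines the list, and
the list determines the term. The AC laws thus become statements about permutations. -/
theorem sort_comb_eq_of_perm (hC : E.IsAC C) {t u : Γ.Term X none}
    (hp : (leaves (orient C) h (sort E orient (comb E orient t))).Perm
      (leaves (orient C) h (sort E orient (comb E orient u)))) :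
    sort E orient (comb E orient t) = sort E orient (comb E orient u) := by
  have e := insertionSort_eq_of_perm hp
  have key : ∀ t : Γ.Term X none,
      (leaves (orient C) h (sort E orient (comb E orient t))).insertionSort (· ≤ ·) =
        leaves (orient C) h (sort E orient (comb E orient t)) := by
    intro t
    refine List.Pairwise.insertionSort_eq ?_
    rw [leaves_sort_comb h hC]
    exact List.pairwise_insertionSort _ _
  rw [key, key] at e
  rw [← mkComb_leaves h (orient C) t (sort E orient (comb E orient t)), e, mkComb_leaves]

theorem perm_leaves_sort_comb_bin (hC : E.IsAC C) (a b : Γ.Term X none) :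
    (leaves (orient C) h (sort E orient (comb E orient (bin h a b)))).Perm
      (leaves (orient C) h (sort E orient (comb E orient a)) ++
        leaves (orient C) h (sort E orient (comb E orient b))) := by
  rw [leaves_sort_comb_bin h hC]
  exact List.perm_insertionSort _ _

theorem sort_comb_app_of_com (hC : E.Com C) (hA : ¬ E.IsAC C) {s : Option P.Srt}
    (h : Γ.IsBin C s) (ts : (i : Fin (Γ.arity C)) → Γ.Term X (Γ.dom C i)) :
    sort E orient (comb E orient (Term.app C ts)) =
      bin h (min (sort E orient (comb E orient (h.arg ts h.pos₀)))
          (sort E orient (comb E orient (h.arg ts h.pos₁))))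
        (max (sort E orient (comb E orient (h.arg ts h.pos₀)))
          (sort E orient (comb E orient (h.arg ts h.pos₁)))) := by
  rw [comb_app_of_not_isAC hA, sort_app_of_com hC hA h, h.arg_map (fun t => comb E orient t),
    h.arg_map (fun t => comb E orient t)]

theorem sort_comb_bin_comm (hC : E.Com C) {s : Option P.Srt} (h : Γ.IsBin C s)
    (a b : Γ.Term X s) :
    sort E orient (comb E orient (bin h a b)) = sort E orient (comb E orient (bin h b a)) := by
  by_cases hA : E.IsAC C
  · obtain rfl := h.sort_unique hA.isBin
    exact sort_comb_eq_of_perm h hA ((perm_leaves_sort_comb_bin h hA _ _).trans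
      (List.perm_append_comm.trans (perm_leaves_sort_comb_bin h hA _ _).symm))
  · rw [bin_eq_app, bin_eq_app, sort_comb_app_of_com hC hA h, sort_comb_app_of_com hC hA h]
    simp only [h.arg_binArgs₀, h.arg_binArgs₁]
    rw [min_comm, max_comm]

theorem sort_comb_bin_assoc (hC : E.IsAC C) (a b c : Γ.Term X none) :
    sort E orient (comb E orient (bin h a (bin h b c))) =
      sort E orient (comb E orient (bin h (bin h a b) c)) := by
  refine sort_comb_eq_of_perm h hC ((perm_leaves_sort_comb_bin h hC _ _).trans ?_)
  refine List.Perm.trans ?_ (perm_leaves_sort_comb_bin h hC _ _).symm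
  refine ((perm_leaves_sort_comb_bin h hC _ _).append_left _).trans ?_
  refine List.Perm.trans ?_ ((perm_leaves_sort_comb_bin h hC _ _).append_right _).symm
  rw [List.append_assoc]

/-- In each of the three kinds of constructor, the canonical form depends on the arguments only
through their canonical forms. -/
theorem sort_comb_congr (C : Γ.Ctor) (ts us : (i : Fin (Γ.arity C)) → Γ.Term X (Γ.dom C i))
    (htu : ∀ i, sort E orient (comb E orient (ts i)) = sort E orient (comb E orient (us i))) :
    sort E orient (comb E orient (Term.app C ts)) =
      sort E orient (comb E orient (Term.app C us)) := by
  by_cases hA : E.IsAC C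
  · have h := hA.isBin
    have htu' := fun i => (rel_arg h (p := fun t u => sort E orient (comb E orient t) =
      sort E orient (comb E orient u)) (ts := ts) (us := us) i).2 (htu i)
    refine sort_comb_eq_of_perm h hA ?_
    rw [app_eq_bin h ts, app_eq_bin h us, leaves_sort_comb_bin h hA, leaves_sort_comb_bin h hA,
      htu', htu']
  · by_cases hC : E.Com C
    · obtain ⟨s, h⟩ := hC.exists_isBin
      have htu' := fun i => (rel_arg h (p := fun t u => sort E orient (comb E orient t) =
        sort E orient (comb E orient u)) (ts := ts) (us := us) i).2 (htu i)
      rw [sort_comb_app_of_com hC hA h, sort_comb_app_of_com hC hA h, htu', htu']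
    · rw [comb_app_of_not_isAC hA, comb_app_of_not_isAC hA, sort_app_of_not_com hC,
        sort_app_of_not_com hC]
      simp only [htu]

/-- AC-equal terms have the same canonical form. -/
theorem ACEqv.sort_comb_eq {s : Option P.Srt} {t t' : Γ.Term X s} (h : E.ACEqv t t') :
    sort E orient (comb E orient t) = sort E orient (comb E orient t') :=
  ACEqv.induct (p := fun t t' => sort E orient (comb E orient t) = sort E orient (comb E orient t'))
    (fun _ _ h a b hC => sort_comb_bin_comm hC h a b)
    (fun _ h a b c hC => sort_comb_bin_assoc h hC a b c)
    (fun _ _ => rfl) (fun _ _ _ => Eq.symm) (fun _ _ _ _ => Eq.trans) sort_comb_congr h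

theorem acEqv_sort_comb {s : Option P.Srt} (t : Γ.Term X s) :
    E.ACEqv (sort E orient (comb E orient t)) t :=
  EqTheory.trans (acEqv_sort _) (acEqv_comb _)

/-! ### AC-normal forms -/

theorem IsACNormal.subterm {s s' : Option P.Srt} {t : Γ.Term X s} {t' : Γ.Term X s'}
    (ht : E.IsACNormal orient t) (h : t'.Subterm t) : E.IsACNormal orient t' where
  comb C hC u hu := ht.comb C hC u (subterm_trans hu h)
  com C s' hb a b hC hA hu := ht.com C s' hb a b hC hA (subterm_trans hu h)

theorem isACNormal_app (D : Γ.Ctor) (ts : (i : Fin (Γ.arity D)) → Γ.Term X (Γ.dom D i))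
    (hts : ∀ i, E.IsACNormal orient (ts i))
    (hcomb : ∀ hD : E.IsAC D, ∃ L, IsComb hD.isBin (orient D) (Term.app D ts) L ∧
      L.Pairwise (· ≤ ·))
    (hcom : ∀ (s : Option P.Srt) (h : Γ.IsBin D s) (a b : Γ.Term X s), E.Com D → ¬ E.IsAC D →
      bin h a b = Term.app D ts → a ≤ b) :
    E.IsACNormal orient (Term.app D ts) where
  comb C hC u hu hu' := by
    cases hu with
    | refl =>
      obtain ⟨us, e⟩ := hu'
      cases e
      exact hcomb hC
    | arg _ _ i hi => exact (hts i).comb C hC u hi hu'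
  com C s hb a b hC hA hu := by
    -- Case analysis on `Subterm` requires the subterm to be a variable rather than a compound
    -- expression.
    generalize hv : bin hb a b = v at hu
    cases hu with
    | refl =>
      have hv' := hv
      rw [bin_eq_app] at hv'
      cases hv'
      exact hcom s hb a b hC hA hv
    | arg _ _ i hi =>
      subst hv
      exact (hts i).com C s hb a b hC hA hi

theorem isACNormal_bin {D : Γ.Ctor} {s : Option P.Srt} (h : Γ.IsBin D s) {a b : Γ.Term X s}
    (ha : E.IsACNormal orient a) (hb : E.IsACNormal orient b)
    (hcomb : ∀ hD : E.IsAC D, ∃ L, IsComb hD.isBin (orient D) (bin h a b) L ∧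
      L.Pairwise (· ≤ ·))
    (hcom : ¬ E.IsAC D → a ≤ b) : E.IsACNormal orient (bin h a b) := by
  refine isACNormal_app D (binArgs h a b) ?_ hcomb ?_
  · intro i
    rw [← prop_arg h (p := fun t => E.IsACNormal orient t)]
    rcases h.eq_pos i with rfl | rfl
    · rwa [h.arg_binArgs₀]
    · rwa [h.arg_binArgs₁]
  · intro s' h' a' b' _ hA e
    obtain rfl := h.sort_unique h'
    obtain ⟨rfl, rfl⟩ := bin_eq_bin h' h e
    exact hcom hA

/-- The nodes of the spine are combs on the suffixes of `l` (right) or its prefixes (left), and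
these inherit sortedness. -/
theorem isACNormal_mkComb (hC : E.IsAC C) (d : Γ.Term X none) {l : List (Γ.Term X none)}
    (hl : l ≠ []) (hl' : ∀ t ∈ l, ¬ t.HeadedBy C) (hn : ∀ t ∈ l, E.IsACNormal orient t)
    (hs : l.Pairwise (· ≤ ·)) : E.IsACNormal orient (mkComb (orient C) h d l) := by
  generalize ho : orient C = o
  revert ho hl' hn hs
  refine comb_induction (p := fun o l => (∀ t ∈ l, ¬ t.HeadedBy C) →
    (∀ t ∈ l, E.IsACNormal orient t) → l.Pairwise (· ≤ ·) → orient C = o →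
      E.IsACNormal orient (mkComb o h d l)) ?_ ?_ ?_ o hl
  · intro o a _ hn _ _
    simpa using hn
  · intro a l hl ih hl' hn hs ho
    have hcomb := isComb_mkComb h (orient C) d (by simp) hl'
    rw [ho, mkComb_right_cons h d d a hl] at hcomb
    rw [mkComb_right_cons h d d a hl]
    refine isACNormal_bin h (hn a (by simp)) (ih (fun t ht => hl' t (by simp [ht]))
      (fun t ht => hn t (by simp [ht])) (List.pairwise_cons.1 hs).2 ho)
      (fun _ => ⟨_, by rw [ho]; exact hcomb, hs⟩) (fun hA => (hA hC).elim)
  · intro a l hl ih hl' hn hs ho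
    have hcomb := isComb_mkComb h (orient C) d (by simp) hl'
    rw [ho, mkComb_left_concat h d d a hl] at hcomb
    rw [mkComb_left_concat h d d a hl]
    refine isACNormal_bin h (ih (fun t ht => hl' t (by simp [ht]))
      (fun t ht => hn t (by simp [ht])) (List.pairwise_append.1 hs).1 ho) (hn a (by simp))
      (fun _ => ⟨_, by rw [ho]; exact hcomb, hs⟩) (fun hA => (hA hC).elim)

theorem isACNormal_sort_comb {s : Option P.Srt} (t : Γ.Term X s) :
    E.IsACNormal orient (sort E orient (comb E orient t)) := by
  induction t with
  | var y =>
    rw [comb, sort]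
    constructor
    · intro C hC u hu hu'
      cases hu
      exact (not_headedBy_var _ hu').elim
    · intro C s' hb a b _ _ hu
      generalize hv : bin hb a b = v at hu
      cases hu
      cases hv
  | const c =>
    rw [comb, sort]
    constructor
    · intro C hC u hu
      cases hu
    · intro C s' hb a b _ _ hu
      cases hu
  | app D ts ih =>
    by_cases hA : E.IsAC D
    · have hb := hA.isBin
      have ih' := fun i => (prop_arg hb
        (p := fun t => E.IsACNormal orient (sort E orient (comb E orient t))) (ts := ts) i).2 (ih i)
      -- The canonical form is viewed as the comb on its own leaves, each a subterm of the canonical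
      -- form of an argument and hence normal by induction.
      rw [← mkComb_leaves hb (orient D) (Term.app D ts) (sort E orient (comb E orient _))]
      refine isACNormal_mkComb hb hA _ (leaves_ne_nil _ _ _)
        (not_headedBy_of_mem_leaves_sort_comb hb hA _) ?_ ?_
      · rw [app_eq_bin hb, leaves_sort_comb_bin hb hA]
        intro t ht
        rw [List.mem_insertionSort, List.mem_append] at ht
        rcases ht with ht | ht
        · exact (ih' _).subterm (subterm_of_mem_leaves hb _ _ t ht)
        · exact (ih' _).subterm (subterm_of_mem_leaves hb _ _ t ht)
      · rw [leaves_sort_comb hb hA]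
        exact List.pairwise_insertionSort _ _
    · by_cases hC : E.Com D
      · obtain ⟨s, hb⟩ := hC.exists_isBin
        have ih' := fun i => (prop_arg hb
          (p := fun t => E.IsACNormal orient (sort E orient (comb E orient t)))
          (ts := ts) i).2 (ih i)
        rw [sort_comb_app_of_com hC hA hb]
        refine isACNormal_bin hb ?_ ?_ (fun hD => (hA hD).elim) (fun _ => min_le_max)
        · rcases min_choice (sort E orient (comb E orient (hb.arg ts hb.pos₀)))
            (sort E orient (comb E orient (hb.arg ts hb.pos₁))) with e | e <;> rw [e] <;>
            exact ih' _
        · rcases max_choice (sort E orient (comb E orient (hb.arg ts hb.pos₀)))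
            (sort E orient (comb E orient (hb.arg ts hb.pos₁))) with e | e <;> rw [e] <;>
            exact ih' _
      · rw [comb_app_of_not_isAC hA, sort_app_of_not_com hC]
        exact isACNormal_app D _ ih (fun hD => (hA hD).elim) (fun _ _ _ _ hD => (hC hD).elim)

end LinearOrder

end RDT

/-! ### From canonical forms to valid construction functions. -/

namespace RDT

open CDT

variable {P : PrimSig.{u, v}} {Γ : CDT.{u, v, w} P} {X : Option P.Srt → Type x} {E : RDT Γ X}
  {R : Set (Γ.TermPair X)}

theorem IsValidNormalization.isValidFamily {f : Γ.GTerm X none → Γ.GTerm X none}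
    (hf : E.IsValidNormalization f) : E.IsValidFamily (familyOf f) where
  correct _ _ _ := hf.correct _
  complete _ _ _ _ _ _ h := hf.complete _ _ h

theorem IsCompletePresentation.exists_isValidNormalization [∀ s, Infinite (X s)]
    [∀ s, LinearOrder (Γ.Term X s)] (hR : E.IsCompletePresentation R) (orient : Γ.Ctor → Side)
    {step : Γ.Term X none → Option (Γ.Term X none)} (hs : E.IsStep R step) :
    ∃ f : Γ.GTerm X none → Γ.GTerm X none,
      (∀ t, ∃ t' ∈ norm step t.1,
        (f t).1 = E.sort orient (E.comb orient t') ∧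
        E.ACEqv (f t).1 t' ∧ E.IsACNormal orient (f t).1) ∧
      E.IsValidNormalization f := by
  -- `n t` is the value of the partial function `norm` at `t`.
  choose n hn hred hnormal using fun t : Γ.GTerm X none => hR.exists_mem_norm hs t.1
  have hg : ∀ t, (E.sort orient (E.comb orient (n t))).Ground := fun t =>
    (acEqv_sort_comb (n t)).ground_iff.2 (hR.ground_of_normal t.2 (hred t) (hnormal t))
  refine ⟨fun t => ⟨_, hg t⟩, fun t => ⟨n t, hn t, rfl, acEqv_sort_comb _,
    isACNormal_sort_comb _⟩, fun t => ?_, fun t t' h => ?_⟩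
  · exact EqTheory.trans (acEqv_sort_comb (n t)).eqv
      (EqTheory.symm (hR.eqv_of_reflTransGen (hred t)))
  · exact Subtype.ext (hR.acEqv_normal_of_eqv h (hred t) (hred t') (hnormal t)
      (hnormal t')).sort_comb_eq

end RDT

theorem mainTheorem1 {P : PrimSig.{u, v}} {Γ : CDT.{u, v, w} P} {X : Option P.Srt → Type x}
    [∀ s, Infinite (X s)] (E : RDT Γ X) :
    (E.HasCompletePresentation → ∃ F : Γ.Family X, E.IsValidFamily F) ∧
    (∀ R : Set (Γ.TermPair X), E.IsCompletePresentation R →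
      ∀ (_ : ∀ s, LinearOrder (Γ.Term X s)) (orient : Γ.Ctor → RDT.Side)
        (step : Γ.Term X none → Option (Γ.Term X none)), E.IsStep R step →
      ∃ f : Γ.GTerm X none → Γ.GTerm X none,
        (∀ t, ∃ t' ∈ RDT.norm step t.1,
          (f t).1 = E.sort orient (E.comb orient t') ∧
          E.ACEqv (f t).1 t' ∧ E.IsACNormal orient (f t).1) ∧
        E.IsValidNormalization f ∧
        E.IsValidFamily (CDT.familyOf f)) := by

  refine ⟨fun ⟨R, hR⟩ => ?_, fun R hR _ orient step hs => ?_⟩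
  -- For bare existence any data will do: a well-ordering obtained by choice, an arbitrary `step`
  -- and left combs everywhere.
  · let _ : ∀ s, LinearOrder (Γ.Term X s) := fun _ => WellOrderingRel.isWellOrder.linearOrder
    obtain ⟨step, hs⟩ := RDT.exists_isStep E R
    obtain ⟨f, -, hf⟩ := hR.exists_isValidNormalization (fun _ => .left) hs
    exact ⟨_, hf.isValidFamily⟩
  · obtain ⟨f, hf, hf'⟩ := hR.exists_isValidNormalization orient hs
    exact ⟨f, hf, hf', hf'.isValidFamily⟩
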